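/- Let $(M,g)$ be a smooth Riemannian two-manifold (Hausdorff, second countable, without boundary) with volume measure $d\mathrm{vol}_g$ and Laplace–Beltrami operator $\Delta_g$, and let $\Omega\subset M$ be open. Let $$\lambda_1=\lambda_1(\Omega)=\inf\Big\{\frac{\int_\Omega|\nabla u|^2\,d\mathrm{vol}_g}{\int_\Omega u^2\,d\mathrm{vol}_g}: u\in C_c^\infty(\Omega),\ u\neq 0\Big\}$$ be the first Dirichlet eigenvalue of $-\Delta_g$ on $\Omega$ (the bottom of the Dirichlet spectrum, if $\Omega$ is not relatively compact; $\lambda_1=0$ if $\Omega=\emptyset$). Let $\kappa:M\to\mathbb R$ be a function and let $\omega\ge 0$ be a weight on $\Omega$ of class $W^{1,2}_{\mathrm{loc}}(\Omega)$ (for example the restriction to $\Omega$ of a weight in $W^{1,2}(M)$), with $\kappa\omega^2\in L^1_{\mathrm{loc}}(\Omega)$, which satisfies $\omega^2\Delta_g\ln\omega=-\kappa\,\omega^2$ weakly in $\Omega$, that is, $$\int_\Omega \big(4|\nabla\omega|^2-2\kappa\,\omega^2\big)\phi-\omega^2\Delta_g\phi\;d\mathrm{vol}_g=0\qquad\text{for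 all }\phi\in C_c^\infty(\Omega).$$ Suppose that $0\le\tau\le 2$ and that $$-\frac{\lambda_1}{8}(2-\tau)\le\kappa\le\lambda_1\qquad\text{almost everywhere in }\Omega.$$ Then for every real-valued $f\in C_c^\infty(\Omega)$, $$\tau\int_\Omega\omega^2|\nabla f|^2\,d\mathrm{vol}_g\;\le\;\int_\Omega \frac{2\,\omega^4}{|\nabla\omega|^2}|\Delta_g f|^2+5|\nabla\omega|^2|f|^2\;d\mathrm{vol}_g .$$ Here the right-hand side takes values in $[0,\infty]$, and at points where $\nabla\omega=0$ the quotient $\omega^4|\Delta_g f|^2/|\nabla\omega|^2$ is read as $0$ if $\omega\,\Delta_g f=0$ and as $+\infty$ otherwise. -/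

import Mathlib

open MeasureTheory Bundle Set
open scoped Manifold ContDiff ENNReal

noncomputable section

namespace Surface

/-- The Euclidean plane, the model space of two-manifolds. -/
abbrev Plane : Type := EuclideanSpace ℝ (Fin 2)

section Smooth

variable {M : Type*} [TopologicalSpace M] [ChartedSpace Plane M]

/-- `φ ∈ C_c^∞(Ω)`: a smooth function on `M` whose support is a compact subset of `Ω`. -/
structure IsTest (Ω : Set M) (φ : M → ℝ) : Prop where
  smooth : ContMDiff (𝓡 2) 𝓘(ℝ, ℝ) ∞ φ
  compact : HasCompactSupport φ
  subset : tsupport φ ⊆ Ω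

/-- The coordinate vector field `∂_i` of the chart `e`, at the point with coordinates `y`. -/
def coordVec (e : OpenPartialHomeomorph M Plane) (y : Plane) (i : Fin 2) :
    TangentSpace (𝓡 2) (e.symm y) :=
  mfderiv (𝓡 2) (𝓡 2) e.symm y
    ((NormedSpace.fromTangentSpace (𝕜 := ℝ) y).symm (EuclideanSpace.single i (1 : ℝ)))

/-- The partial derivative `∂_i u` of a function on the plane. -/
def partialD (i : Fin 2) (u : Plane → ℝ) (y : Plane) : ℝ :=
  fderiv ℝ u y (EuclideanSpace.single i (1 : ℝ))

/-- The part of the open set `Ω` covered by the chart `e`, in coordinates. -/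
def coordDomain (e : OpenPartialHomeomorph M Plane) (Ω : Set M) : Set Plane :=
  e.target ∩ e.symm ⁻¹' Ω

/-- The section `dw` of the cotangent bundle is the weak (distributional) differential of the
function `w` on the open set `Ω`: in every chart, the coordinate expression of `w` and the
components of `dw` are locally integrable, and the components of `dw` are the weak partial
derivatives of the coordinate expression of `w`. -/
structure IsWeakDifferential (Ω : Set M) (w : M → ℝ)
    (dw : ∀ p : M, TangentSpace (𝓡 2) p →L[ℝ] ℝ) : Prop where
  locallyIntegrable : ∀ e ∈ atlas Plane M,
    LocallyIntegrableOn (fun y => w (e.symm y)) (coordDomain e Ω) volume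
  locallyIntegrable_component : ∀ e ∈ atlas Plane M, ∀ i : Fin 2,
    LocallyIntegrableOn (fun y => dw (e.symm y) (coordVec e y i)) (coordDomain e Ω) volume
  integral_by_parts : ∀ e ∈ atlas Plane M, ∀ i : Fin 2, ∀ φ : Plane → ℝ,
    ContDiff ℝ ∞ φ → HasCompactSupport φ → tsupport φ ⊆ coordDomain e Ω →
      ∫ y in coordDomain e Ω, w (e.symm y) * partialD i φ y
        = - ∫ y in coordDomain e Ω, dw (e.symm y) (coordVec e y i) * φ y

end Smooth

section Riemannian

variable {M : Type*} [TopologicalSpace M] [ChartedSpace Plane M]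
  [RiemannianBundle (fun p : M => TangentSpace (𝓡 2) p)]

/-- The matrix `g_ij` of the Riemannian metric in the chart `e`. -/
def metricMatrix (e : OpenPartialHomeomorph M Plane) (y : Plane) : Matrix (Fin 2) (Fin 2) ℝ :=
  Matrix.of fun i j => inner ℝ (coordVec e y i) (coordVec e y j)

/-- The Riemannian volume density `√(det g_ij)` in the chart `e`. -/
def volDensity (e : OpenPartialHomeomorph M Plane) (y : Plane) : ℝ :=
  √(metricMatrix e y).det

/-- The squared length `|α|_g²` of a covector, for the norm dual to the Riemannian metric. -/
def covecNormSq {p : M} (α : TangentSpace (𝓡 2) p →L[ℝ] ℝ) : ℝ := ‖α‖ ^ 2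

/-- `|∇f|²` for a differentiable function `f`. -/
def gradSq (f : M → ℝ) (p : M) : ℝ := covecNormSq (mvfderiv (𝓡 2) f p)

/-- The Laplace-Beltrami operator
`Δ_g f = (1 / √det g) ∑_i ∂_i (√det g ∑_j g^{ij} ∂_j f)` on smooth functions, computed in the
preferred chart at the point. -/
def laplaceBeltrami (f : M → ℝ) (p : M) : ℝ :=
  let e := chartAt Plane p
  (volDensity e (e p))⁻¹ *
    ∑ i, partialD i
      (fun y => volDensity e y * ∑ j, (metricMatrix e y)⁻¹ i j * partialD j (f ∘ e.symm) y) (e p)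

variable [MeasurableSpace M]

/-- The Riemannian volume on the domain of the chart `e`, as a measure on `M`: the image of
`√(det g_ij) dy` under the inverse of the chart. -/
def chartVolume (e : OpenPartialHomeomorph M Plane) : Measure M :=
  Measure.map e.symm
    ((volume.restrict e.target).withDensity fun y => ENNReal.ofReal (volDensity e y))

variable (M) in
/-- The Riemannian volume measure `dvol_g`. The measures `chartVolume e` are the restrictions of
one measure to the domains of the charts (change of variables); it is their supremum. -/
def riemVolume : Measure M := ⨆ e ∈ atlas Plane M, chartVolume e

/-- The first Dirichlet eigenvalue `λ₁(Ω)` of `-Δ_g`, that is, the infimum of the Rayleigh quotients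
`∫_Ω |∇u|² / ∫_Ω u²` over the nonzero `u ∈ C_c^∞(Ω)`. -/
def dirichletEigenvalue (Ω : Set M) : ℝ :=
  sInf {r : ℝ | ∃ u : M → ℝ, IsTest Ω u ∧ u ≠ 0 ∧
    r = (∫ p in Ω, gradSq u p ∂riemVolume M) / ∫ p in Ω, u p ^ 2 ∂riemVolume M}

/-- `w`, with weak differential `dw`, is a nonnegative weight on `Ω` of class `W^{1,2}_loc` that
weakly satisfies `w² Δ_g ln w = -κ w²`. The integrability of `κ w²` on compact subsets of `Ω` is
what gives the weak formulation a meaning. -/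
structure IsWeight (Ω : Set M) (κ w : M → ℝ)
    (dw : ∀ p : M, TangentSpace (𝓡 2) p →L[ℝ] ℝ) : Prop where
  nonneg : ∀ᵐ p ∂(riemVolume M).restrict Ω, 0 ≤ w p
  weakDifferential : IsWeakDifferential Ω w dw
  sq_integrable : LocallyIntegrableOn (fun p => w p ^ 2) Ω (riemVolume M)
  grad_sq_integrable : LocallyIntegrableOn (fun p => covecNormSq (dw p)) Ω (riemVolume M)
  curv_integrable : LocallyIntegrableOn (fun p => κ p * w p ^ 2) Ω (riemVolume M)
  equation : ∀ φ : M → ℝ, IsTest Ω φ →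
    ∫ p in Ω, ((4 * covecNormSq (dw p) - 2 * κ p * w p ^ 2) * φ p
      - w p ^ 2 * laplaceBeltrami φ p) ∂riemVolume M = 0

end Riemannian

end Surface

end

set_option linter.unusedSectionVars false

open MeasureTheory Bundle Set Filter Topology
open scoped Manifold ContDiff ENNReal Convolution

namespace Surface

/-! Write A = ∫ω²|∇f|², B = ∫|∇ω|²f², K = ∫κω²f², C = ∫ω²fΔf, C' = ∫|ω²fΔf| and W = ∫ω²f². Two
relations carry the proof.

Testing the equation for ω with φ = f² and using Δ(f²) = 2|∇f|² + 2fΔf gives A = 2B − K − C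
(`IsWeight.integral_sq_mul_gradSq`). The function fω is also admissible in the Rayleigh quotient.
Its energy is B + A + ∫ω⟨∇ω,∇(f²)⟩, and the last integral equals −½∫ω²Δ(f²) = −A − C, so A cancels
and λ₁W ≤ B − C (`IsWeight.dirichletEigenvalue_mul_le`).

The lower bound on κ gives −K ≤ (2−τ)/8 · λ₁W ≤ (2−τ)/8 · (B + C'). Hence A ≤ (2+(2−τ)/8)B +
(1+(2−τ)/8)C'. After multiplication by τ ∈ [0,2] the coefficients are at most 4 and 2, so τA ≤ 4B +
2C'. The pointwise inequality 2|ω²fΔf| ≤ ω⁴|Δf|²/|∇ω|² + |∇ω|²f² finishes the argument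
(`ofReal_add_two_mul_abs_le`).

The bulk of the work is to justify this for ω merely in W^{1,2}_loc on a manifold. Two facts are
needed: the weak chain rule 2ω dω = d(ω²) (`IsSobolev.integral_sq_mul_partialD`,
`IsWeight.integral_mul_covecInner`), and the approximation of fω in W^{1,2} by test functions
(`IsSobolev.exists_approx`, `IsWeight.isTestLimit`). Both are proved in the plane by mollification
and carried to `M` by charts and a partition of unity. The transfer rests on the chart measures
being restrictions of one measure (`riemVolume_restrict_source`), on Green's formula in a chart
(`integral_mul_divGrad_eq`), and on the chart independence of the Laplacian
(`inv_volDensity_mul_divGrad_eq`). -/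

/-! ### Mollification in L² of the plane. -/

theorem exists_pos_eLpNorm_translate_sub_le {g : Plane → ℝ} (hg : MemLp g 2 volume) {δ : ℝ≥0∞}
    (hδ : 0 < δ) :
    ∃ ε > 0, ∀ t : Plane, ‖t‖ < ε → eLpNorm (fun x => g (x - t) - g x) 2 volume ≤ δ := by
  let T : Plane → C(Plane, Plane) := fun t => ⟨fun x => x - t, continuous_id.sub continuous_const⟩
  have hT : Continuous T := ContinuousMap.continuous_of_continuous_uncurry _
    (continuous_snd.sub continuous_fst)
  have hm : ∀ t, MeasurePreserving (T t) volume volume := fun t => measurePreserving_sub_right _ t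
  -- Translations act continuously on L²; the claim is continuity of the orbit of `g` at `t = 0`.
  have hc : Continuous fun t => Lp.compMeasurePreserving (T t) (hm t) (hg.toLp g) :=
    continuous_const.compMeasurePreservingLp hT hm (by simp)
  have h0 := EMetric.tendsto_nhds.1 (hc.tendsto 0) δ hδ
  obtain ⟨ε, hε, h⟩ := Metric.eventually_nhds_iff.1 h0
  refine ⟨ε, hε, fun t ht => ?_⟩
  have h1 := (h (y := t) (by simpa using ht)).le
  refine le_trans (le_of_eq ?_) h1
  rw [Lp.edist_def]
  refine eLpNorm_congr_ae ?_
  have e1 := Lp.coeFn_compMeasurePreserving (hg.toLp g) (hm t)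
  have e2 := Lp.coeFn_compMeasurePreserving (hg.toLp g) (hm 0)
  have e3 := (hm t).quasiMeasurePreserving.ae_eq_comp hg.coeFn_toLp
  have e4 := (hm 0).quasiMeasurePreserving.ae_eq_comp hg.coeFn_toLp
  filter_upwards [e1, e2, e3, e4] with x h1 h2 h3 h4
  simp only [Pi.sub_apply, h1, h2, h3, h4]
  simp [T]

/-- The normed bump is a probability density, so the mollification error at `x` is an average of the
differences g(x − t) − g(x). Jensen's inequality bounds its square by the average of the squares,
and Tonelli turns the integral over `x` into an average of squared translation errors. Only shifts
with `‖t‖ < φ.rOut` carry mass. -/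
theorem eLpNorm_normed_convolution_sub_le {g : Plane → ℝ} (hg : MemLp g 2 volume)
    (φ : ContDiffBump (0 : Plane)) {δ : ℝ≥0∞}
    (h : ∀ t : Plane, ‖t‖ < φ.rOut → eLpNorm (fun x => g (x - t) - g x) 2 volume ≤ δ) :
    eLpNorm (φ.normed volume ⋆[ContinuousLinearMap.lsmul ℝ ℝ, volume] g - g) 2 volume ≤ δ := by
  set ρ := φ.normed (volume : Measure Plane) with hρ
  have hρm : Measurable ρ := φ.continuous_normed.measurable
  have hρ0 : ∀ t, 0 ≤ ρ t := φ.nonneg_normed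
  have hρ1 : ∫⁻ t, ENNReal.ofReal (ρ t) = 1 := by
    rw [← ofReal_integral_eq_lintegral_ofReal φ.integrable_normed (ae_of_all _ hρ0),
      φ.integral_normed, ENNReal.ofReal_one]
  set P : Measure Plane := volume.withDensity fun t => ENNReal.ofReal (ρ t) with hP
  have hPp : IsProbabilityMeasure P := ⟨by rw [hP, withDensity_apply _ .univ]; simpa using hρ1⟩
  have hgl : LocallyIntegrable g volume := hg.locallyIntegrable (by norm_num)
  have hsub : AEStronglyMeasurable (fun z : Plane × Plane => g (z.1 - z.2) - g z.1)
      (volume.prod volume) :=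
    (hg.1.comp_quasiMeasurePreserving
      (quasiMeasurePreserving_sub_of_right_invariant volume volume)).sub hg.1.comp_fst
  have key : ∀ᵐ x : Plane, ‖(ρ ⋆[ContinuousLinearMap.lsmul ℝ ℝ, volume] g - g) x‖ₑ ^ (2 : ℝ) ≤
      ∫⁻ t, ENNReal.ofReal (ρ t) * ‖g (x - t) - g x‖ₑ ^ (2 : ℝ) := by
    filter_upwards [hsub.prodMk_left] with x hx
    have e : (ρ ⋆[ContinuousLinearMap.lsmul ℝ ℝ, volume] g - g) x
        = ∫ t, ρ t * (g (x - t) - g x) := by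
      have i1 : Integrable (fun t => ρ t * g (x - t)) := by
        have := (φ.hasCompactSupport_normed (μ := volume)).convolutionExists_left
          (ContinuousLinearMap.lsmul ℝ ℝ) φ.continuous_normed hgl x
        simpa [ConvolutionExistsAt] using this
      have i2 : Integrable (fun t => ρ t * g x) := φ.integrable_normed.mul_const _
      simp only [Pi.sub_apply, convolution, ContinuousLinearMap.lsmul_apply, smul_eq_mul, mul_sub]
      rw [integral_sub i1 i2, integral_mul_const, φ.integral_normed, one_mul]
    have e2 : ‖∫ t, ρ t * (g (x - t) - g x)‖ₑ ≤ ∫⁻ t, ‖g (x - t) - g x‖ₑ ∂P := by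
      refine (enorm_integral_le_lintegral_enorm _).trans (le_of_eq ?_)
      rw [hP, lintegral_withDensity_eq_lintegral_mul_non_measurable _ hρm.ennreal_ofReal
        (ae_of_all _ fun _ => ENNReal.ofReal_lt_top)]
      refine lintegral_congr fun t => ?_
      simp [enorm_mul, Real.enorm_of_nonneg (hρ0 t)]
    have hxP : AEStronglyMeasurable (fun t => g (x - t) - g x) P :=
      hx.mono_ac (withDensity_absolutelyContinuous _ _)
    -- Jensen's inequality, in the form that the L¹ norm is at most the L² norm on a probability
    -- space.
    have e3 := eLpNorm_le_eLpNorm_of_exponent_le (μ := P) (p := 1) (q := 2) (by norm_num) hxP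
    rw [eLpNorm_one_eq_lintegral_enorm, eLpNorm_eq_lintegral_rpow_enorm_toReal (by norm_num) (by norm_num)] at e3
    rw [e]
    calc _ ≤ ((∫⁻ t, ‖g (x - t) - g x‖ₑ ^ (2 : ℝ) ∂P) ^ (1 / (2 : ℝ))) ^ (2 : ℝ) := by
          refine ENNReal.rpow_le_rpow (e2.trans ?_) (by norm_num)
          simpa using e3
      _ = ∫⁻ t, ‖g (x - t) - g x‖ₑ ^ (2 : ℝ) ∂P := by
          rw [← ENNReal.rpow_mul]; norm_num
      _ = _ := by
          rw [hP, lintegral_withDensity_eq_lintegral_mul_non_measurable _ hρm.ennreal_ofReal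
            (ae_of_all _ fun _ => ENNReal.ofReal_lt_top)]
          rfl
  have fin : ∫⁻ x, ‖(ρ ⋆[ContinuousLinearMap.lsmul ℝ ℝ, volume] g - g) x‖ₑ ^ (2 : ℝ)
      ≤ δ ^ (2 : ℝ) := by
    refine (lintegral_mono_ae key).trans ?_
    rw [lintegral_lintegral_swap]
    · calc _ ≤ ∫⁻ t, ENNReal.ofReal (ρ t) * δ ^ (2 : ℝ) := by
            refine lintegral_mono fun t => ?_
            by_cases ht : ‖t‖ < φ.rOut
            · rw [lintegral_const_mul' _ _ ENNReal.ofReal_ne_top]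
              gcongr
              have := h t ht
              rw [eLpNorm_eq_lintegral_rpow_enorm_toReal (by norm_num) (by norm_num)] at this
              have := ENNReal.rpow_le_rpow this (z := 2) (by norm_num)
              rw [← ENNReal.rpow_mul] at this
              norm_num at this ⊢
              exact this
            · have : ρ t = 0 := by
                have : t ∉ Function.support ρ := by
                  rw [hρ, φ.support_normed_eq]; simpa using ht
                simpa using this
              simp [this]
        _ = _ := by rw [lintegral_mul_const _ hρm.ennreal_ofReal, hρ1, one_mul]
    · exact ((hρm.ennreal_ofReal.comp measurable_snd).aemeasurable).mul
        (hsub.enorm.pow_const _)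
  rw [eLpNorm_eq_lintegral_rpow_enorm_toReal (by norm_num) (by norm_num)]
  have := ENNReal.rpow_le_rpow fin (z := 1 / 2) (by norm_num)
  rw [← ENNReal.rpow_mul] at this
  norm_num at this ⊢
  exact this

/-! ### Sobolev functions on open subsets of the plane. -/

theorem hasCompactSupport_partialD {χ : Plane → ℝ} (h : HasCompactSupport χ) (i : Fin 2) :
    HasCompactSupport (partialD i χ) := h.fderiv_apply ℝ _

theorem tsupport_partialD_subset (χ : Plane → ℝ) (i : Fin 2) :
    tsupport (partialD i χ) ⊆ tsupport χ := tsupport_fderiv_apply_subset ℝ _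

theorem contDiff_partialD {χ : Plane → ℝ} (h : ContDiff ℝ ∞ χ) (i : Fin 2) :
    ContDiff ℝ ∞ (partialD i χ) :=
  (h.fderiv_right (m := ∞) (by simp)).clm_apply contDiff_const

theorem partialD_mul {a b : Plane → ℝ} {y : Plane} (ha : DifferentiableAt ℝ a y)
    (hb : DifferentiableAt ℝ b y) (i : Fin 2) :
    partialD i (fun z => a z * b z) y = a y * partialD i b y + partialD i a y * b y := by
  simp only [partialD]
  rw [fderiv_fun_mul ha hb]
  simp [mul_comm]

/-- The function `u` on the open set `U` of the plane belongs to `W^{1,2}_loc(U)`, with weak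
partial derivatives `du i`. -/
structure IsSobolev (U : Set Plane) (u : Plane → ℝ) (du : Fin 2 → Plane → ℝ) : Prop where
  locallyIntegrable : LocallyIntegrableOn u U
  sq : LocallyIntegrableOn (fun y => u y ^ 2) U
  locallyIntegrable_deriv : ∀ i, LocallyIntegrableOn (du i) U
  sq_deriv : ∀ i, LocallyIntegrableOn (fun y => du i y ^ 2) U
  integral_by_parts : ∀ i, ∀ φ : Plane → ℝ, ContDiff ℝ ∞ φ → HasCompactSupport φ →
    tsupport φ ⊆ U → ∫ y in U, u y * partialD i φ y = - ∫ y in U, du i y * φ y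

theorem memLp_mul_of_tsupport_subset {U : Set Plane} {u χ : Plane → ℝ}
    (hu : LocallyIntegrableOn u U) (hu2 : LocallyIntegrableOn (fun y => u y ^ 2) U)
    (hχ : Continuous χ) (hc : HasCompactSupport χ) (hs : tsupport χ ⊆ U) :
    MemLp (fun y => χ y * u y) 2 volume := by
  have hK : IsCompact (tsupport χ) := hc
  have h1 : MemLp u 2 (volume.restrict (tsupport χ)) :=
    (memLp_two_iff_integrable_sq (hu.integrableOn_compact_subset hs hK).1).2
      (hu2.integrableOn_compact_subset hs hK)
  obtain ⟨C, hC⟩ := hc.exists_bound_of_continuous hχ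
  have h2 : MemLp (fun y => χ y * u y) 2 (volume.restrict (tsupport χ)) :=
    MemLp.of_le_mul (c := C) h1 (hχ.aestronglyMeasurable.mul h1.1) (ae_of_all _ fun y => by
      rw [norm_mul]; gcongr; exact hC y)
  rw [← memLp_indicator_iff_restrict (isClosed_tsupport χ).measurableSet] at h2
  convert! h2 using 1
  refine funext fun y => ?_
  by_cases hy : y ∈ tsupport χ
  · simp [hy]
  · simp [hy, image_eq_zero_of_notMem_tsupport hy]

/-- The weak Leibniz rule for χu, obtained by testing the weak derivative of `u` against χφ. The
cut-off already supplies compact support, so `φ` may be any smooth function; this freedom is what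
allows a reflected and translated mollifier as `φ`. -/
theorem IsSobolev.integral_mul_partialD {U : Set Plane} {u : Plane → ℝ} {du : Fin 2 → Plane → ℝ}
    (h : IsSobolev U u du) {χ φ : Plane → ℝ} (hχ : ContDiff ℝ ∞ χ) (hc : HasCompactSupport χ)
    (hs : tsupport χ ⊆ U) (hφ : ContDiff ℝ ∞ φ) (i : Fin 2) :
    ∫ y, χ y * u y * partialD i φ y
      = - ∫ y, (χ y * du i y + partialD i χ y * u y) * φ y := by
  have hprod : tsupport (fun y => χ y * φ y) ⊆ U := (tsupport_mul_subset_left).trans hs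
  have hb := h.integral_by_parts i _ (hχ.mul hφ) (hc.mul_right) hprod
  have z : ∀ y ∉ U, χ y = 0 := fun y hy =>
    image_eq_zero_of_notMem_tsupport fun h => hy (hs h)
  have z' : ∀ y ∉ U, partialD i χ y = 0 := fun y hy =>
    image_eq_zero_of_notMem_tsupport fun h => hy (hs (tsupport_partialD_subset χ i h))
  have hd : ∀ y, partialD i (fun y => χ y * φ y) y
      = χ y * partialD i φ y + partialD i χ y * φ y := fun y =>
    partialD_mul (hχ.differentiable (by simp) y) (hφ.differentiable (by simp) y) i
  have hd' : partialD i (fun y => χ y * φ y)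
      = fun y => χ y * partialD i φ y + partialD i χ y * φ y := funext hd
  rw [setIntegral_eq_integral_of_forall_compl_eq_zero
      (fun y hy => by simp [hd, z y hy, z' y hy]),
    setIntegral_eq_integral_of_forall_compl_eq_zero (fun y hy => by simp [z y hy])] at hb
  have loc : ∀ {ψ : Plane → ℝ} {f : Plane → ℝ}, LocallyIntegrableOn f U → ContDiff ℝ ∞ ψ →
      HasCompactSupport ψ → tsupport ψ ⊆ U → Integrable fun y => f y * ψ y := by
    intro ψ f hf hψ hcψ hsψ
    have h1 : IntegrableOn (fun y => f y * ψ y) (tsupport ψ) :=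
      (hf.integrableOn_compact_subset hsψ hcψ).mul_continuousOn hψ.continuous.continuousOn hcψ
    rwa [integrableOn_iff_integrable_of_support_subset] at h1
    exact (Function.support_mul_subset_right _ _).trans (subset_tsupport _)
  have i1 := loc (h.locallyIntegrable) (hχ.mul (contDiff_partialD hφ i)) hc.mul_right
    (tsupport_mul_subset_left.trans hs)
  have i2 := loc (h.locallyIntegrable) ((contDiff_partialD hχ i).mul hφ)
    (hasCompactSupport_partialD hc i).mul_right
    (tsupport_mul_subset_left.trans ((tsupport_partialD_subset χ i).trans hs))
  have i3 := loc (h.locallyIntegrable_deriv i) (hχ.mul hφ) hc.mul_right hprod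
  simp_rw [hd, mul_add] at hb
  rw [integral_add i1 i2] at hb
  have e1 : ∫ y, (χ y * du i y + partialD i χ y * u y) * φ y
      = (∫ y, du i y * (χ y * φ y)) + ∫ y, u y * (partialD i χ y * φ y) := by
    rw [← integral_add i3 i2]; congr 1; ext y; ring
  have e2 : ∫ y, χ y * u y * partialD i φ y = ∫ y, u y * (χ y * partialD i φ y) := by
    congr 1; ext y; ring
  rw [e1, e2]; linarith

/-- The derivative falls on the smooth factor ρ and is then moved to χu by the weak Leibniz rule
with φ(y) = ρ(x − y). The sign from ∂_y ρ(x − y) = −(∂ρ)(x − y) cancels the one from integration by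
parts. -/
theorem IsSobolev.partialD_convolution {U : Set Plane} {u : Plane → ℝ} {du : Fin 2 → Plane → ℝ}
    (h : IsSobolev U u du) {χ ρ : Plane → ℝ} (hχ : ContDiff ℝ ∞ χ) (hc : HasCompactSupport χ)
    (hs : tsupport χ ⊆ U) (hρ : ContDiff ℝ ∞ ρ) (hcρ : HasCompactSupport ρ) (i : Fin 2)
    (x : Plane) :
    partialD i (ρ ⋆[ContinuousLinearMap.lsmul ℝ ℝ, volume] fun y => χ y * u y) x
      = (ρ ⋆[ContinuousLinearMap.lsmul ℝ ℝ, volume]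
          fun y => χ y * du i y + partialD i χ y * u y) x := by
  have hG : LocallyIntegrable (fun y => χ y * u y) volume :=
    (memLp_mul_of_tsupport_subset h.locallyIntegrable h.sq hχ.continuous hc hs).locallyIntegrable
      (by norm_num)
  have h1 := hcρ.hasFDerivAt_convolution_left (ContinuousLinearMap.lsmul ℝ ℝ)
    (hρ.of_le (by simp)) hG x
  have h2 := h.integral_mul_partialD hχ hc hs (φ := fun y => ρ (x - y))
    (hρ.comp (contDiff_const.sub contDiff_id)) i
  have h3 : ∀ y, partialD i (fun y => ρ (x - y)) y = - partialD i ρ (x - y) := by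
    intro y
    have : HasFDerivAt (fun y => ρ (x - y)) (-(fderiv ℝ ρ (x - y))) y := by
      have := ((hρ.differentiable (by simp) (x - y)).hasFDerivAt).comp y
        ((hasFDerivAt_id y).const_sub x)
      convert! this using 1
      ext v; simp
    simp [partialD, this.fderiv]
  have hex := (hcρ.fderiv (𝕜 := ℝ)).convolutionExists_left
    ((ContinuousLinearMap.lsmul ℝ ℝ).precompL Plane)
    (hρ.continuous_fderiv (by simp)) hG x
  rw [partialD, h1.fderiv, convolution_def, ContinuousLinearMap.integral_apply hex]
  rw [convolution_eq_swap]
  simp only [h3, mul_neg, integral_neg, neg_inj] at h2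
  simp only [ContinuousLinearMap.precompL_apply, ContinuousLinearMap.lsmul_apply, smul_eq_mul]
  rw [← integral_sub_left_eq_self _ volume x]
  simp only [sub_sub_cancel]
  convert! h2 using 1 <;> congr 1 <;> ext y
  · simp [partialD, mul_comm]
  · simp [mul_comm]

theorem integrable_sq_and_integral_sq_le {g : Plane → ℝ} (hg : MemLp g 2 volume) {δ : ℝ}
    (hδ : 0 ≤ δ) (h : eLpNorm g 2 volume ≤ ENNReal.ofReal √δ) :
    Integrable (fun y => g y ^ 2) ∧ ∫ y, g y ^ 2 ≤ δ := by
  refine ⟨(memLp_two_iff_integrable_sq hg.1).1 hg, ?_⟩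
  have h2 := hg.eLpNorm_eq_integral_rpow_norm (by norm_num) (by norm_num)
  rw [h2] at h
  have h0 : 0 ≤ ∫ y, g y ^ 2 := integral_nonneg fun y => sq_nonneg _
  have h3 := (ENNReal.ofReal_le_ofReal_iff (Real.sqrt_nonneg _)).1 h
  norm_num at h3
  rw [← Real.sqrt_eq_rpow] at h3
  exact (Real.sqrt_le_sqrt_iff hδ).1 h3

/-- Local Meyers-Serrin approximation: the product of a `W^{1,2}_loc` function with a cut-off
function is the `W^{1,2}` limit of test functions supported in a fixed compact set. -/
theorem IsSobolev.exists_approx {U : Set Plane} (hU : IsOpen U) {u : Plane → ℝ}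
    {du : Fin 2 → Plane → ℝ} (h : IsSobolev U u du) {χ : Plane → ℝ} (hχ : ContDiff ℝ ∞ χ)
    (hc : HasCompactSupport χ) (hs : tsupport χ ⊆ U) :
    ∃ K ⊆ U, IsCompact K ∧ tsupport χ ⊆ K ∧ ∀ δ > 0, ∃ v : Plane → ℝ, ContDiff ℝ ∞ v ∧ tsupport v ⊆ K ∧
      (Integrable (fun y => (v y - χ y * u y) ^ 2) ∧ ∫ y, (v y - χ y * u y) ^ 2 ≤ δ) ∧
      ∀ i, Integrable
          (fun y => (partialD i v y - (χ y * du i y + partialD i χ y * u y)) ^ 2) ∧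
        ∫ y, (partialD i v y - (χ y * du i y + partialD i χ y * u y)) ^ 2 ≤ δ := by
  obtain ⟨r, hr, hrU⟩ := (show IsCompact (tsupport χ) from hc).exists_cthickening_subset_open hU hs
  refine ⟨Metric.cthickening r (tsupport χ), hrU, IsCompact.cthickening hc,
    Metric.self_subset_cthickening _, fun δ hδ => ?_⟩
  have hδ' : 0 < ENNReal.ofReal √δ := by simpa using hδ
  have hG := memLp_mul_of_tsupport_subset h.locallyIntegrable h.sq hχ.continuous hc hs
  have hGi : ∀ i, MemLp (fun y => χ y * du i y + partialD i χ y * u y) 2 volume := fun i =>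
    (memLp_mul_of_tsupport_subset (h.locallyIntegrable_deriv i) (h.sq_deriv i) hχ.continuous hc
      hs).add (memLp_mul_of_tsupport_subset h.locallyIntegrable h.sq
        (contDiff_partialD hχ i).continuous (hasCompactSupport_partialD hc i)
        ((tsupport_partialD_subset χ i).trans hs))
  obtain ⟨ε, hε, h1⟩ := exists_pos_eLpNorm_translate_sub_le hG hδ'
  choose η hη h2 using fun i => exists_pos_eLpNorm_translate_sub_le (hGi i) hδ'
  -- The bound `R ≤ r` keeps the support of the mollified function in the thickening, which does not
  -- depend on `δ`. The bounds by `ε` and `η i` control the L² errors of the function and of its two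
  -- derivatives.
  set R := min (min ε r) (min (η 0) (η 1)) with hR
  have hRpos : 0 < R := by simp [hR, hε, hr, hη]
  have hRη : ∀ i, R ≤ η i := by
    intro i; fin_cases i <;> simp [hR]
  let φ : ContDiffBump (0 : Plane) := ⟨R / 2, R, by positivity, by linarith⟩
  have hφc : ContDiff ℝ ∞ (φ.normed volume) := φ.contDiff_normed
  have hφs : HasCompactSupport (φ.normed volume) := φ.hasCompactSupport_normed
  have e1 := eLpNorm_normed_convolution_sub_le hG φ
    fun t ht => h1 t (lt_of_lt_of_le ht (by simp [φ, hR]))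
  have e2 := fun i => eLpNorm_normed_convolution_sub_le (hGi i) φ
    fun t ht => h2 i t (lt_of_lt_of_le ht (hRη i))
  have hv : ContDiff ℝ ∞ (φ.normed volume ⋆[ContinuousLinearMap.lsmul ℝ ℝ, volume]
      fun y => χ y * u y) :=
    hφs.contDiff_convolution_left _ hφc (hG.locallyIntegrable (by norm_num))
  have mv : ∀ {w g : Plane → ℝ}, Continuous w → MemLp g 2 volume →
      eLpNorm (w - g) 2 volume ≤ ENNReal.ofReal √δ → MemLp (fun y => w y - g y) 2 volume :=
    fun hw hg hle => ⟨(hw.aestronglyMeasurable.sub hg.1), hle.trans_lt ENNReal.ofReal_lt_top⟩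
  refine ⟨_, hv, ?_, integrable_sq_and_integral_sq_le (mv hv.continuous hG e1) hδ.le e1,
    fun i => ?_⟩
  · refine closure_minimal ?_ Metric.isClosed_cthickening
    refine (support_convolution_subset _).trans ?_
    rintro _ ⟨a, ha, b, hb, rfl⟩
    rw [φ.support_normed_eq] at ha
    have hb' : b ∈ tsupport χ := subset_tsupport _ (Function.support_mul_subset_left _ _ hb)
    refine Metric.mem_cthickening_of_dist_le (a + b) b r _ hb' ?_
    have : ‖a‖ < R := by simpa [φ] using ha
    simp only [dist_eq_norm, add_sub_cancel_right]
    exact this.le.trans (by simp [hR])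
  · have e : partialD i (φ.normed volume ⋆[ContinuousLinearMap.lsmul ℝ ℝ, volume]
        fun y => χ y * u y) = _ := funext (h.partialD_convolution hχ hc hs hφc hφs i)
    have e3 := e2 i
    rw [← e] at e3
    exact integrable_sq_and_integral_sq_le (mv (contDiff_partialD hv i).continuous (hGi i) e3)
      hδ.le e3

/-- The cut-off equals 1 near `K` and not only on `K`, so its derivatives vanish on `K`: multiplying
by it changes there neither a Sobolev function nor its weak derivatives. -/
theorem exists_cutoff {U : Set Plane} (hU : IsOpen U) {K : Set Plane} (hK : IsCompact K)
    (hKU : K ⊆ U) : ∃ χ : Plane → ℝ, ContDiff ℝ ∞ χ ∧ HasCompactSupport χ ∧ tsupport χ ⊆ U ∧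
      ∀ᶠ y in 𝓝ˢ K, χ y = 1 := by
  obtain ⟨L, hL, hKL, hLU⟩ := exists_compact_between hK hU hKU
  obtain ⟨f, h0, h1, -⟩ := exists_contMDiffMap_zero_one_nhds_of_isClosed 𝓘(ℝ, Plane) (n := ⊤)
    (s := (interior L)ᶜ) (t := K) isOpen_interior.isClosed_compl hK.isClosed
    (disjoint_compl_left_iff_subset.2 hKL)
  have hs : tsupport f ⊆ L := by
    refine closure_minimal (fun y hy => ?_) hL.isClosed
    by_contra hyL
    exact hy (h0.self_of_nhdsSet y fun h => hyL (interior_subset h))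
  exact ⟨f, f.contMDiff.contDiff, hL.of_isClosed_subset (isClosed_tsupport _) hs, hs.trans hLU, h1⟩

theorem partialD_eq_zero_of_eventuallyEq_const {χ : Plane → ℝ} {y : Plane} {c : ℝ}
    (h : ∀ᶠ z in 𝓝 y, χ z = c) (i : Fin 2) : partialD i χ y = 0 := by
  have : χ =ᶠ[𝓝 y] fun _ => c := h
  simp [partialD, this.fderiv_eq]

theorem IsSobolev.integrable_mul_deriv_mul {U : Set Plane} (hU : IsOpen U) {u : Plane → ℝ}
    {du : Fin 2 → Plane → ℝ} (h : IsSobolev U u du) {X : Plane → ℝ} (hX : ContDiff ℝ ∞ X)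
    (hc : HasCompactSupport X) (hs : tsupport X ⊆ U) (i : Fin 2) :
    Integrable (fun y => u y * du i y * X y) := by
  obtain ⟨χ, hχ, hcχ, hsχ, h1⟩ := exists_cutoff hU hc hs
  have a := memLp_mul_of_tsupport_subset h.locallyIntegrable h.sq hχ.continuous hcχ hsχ
  have b := memLp_mul_of_tsupport_subset (h.locallyIntegrable_deriv i) (h.sq_deriv i)
    hX.continuous hc hs
  convert! a.integrable_mul b using 1
  ext y
  by_cases hy : y ∈ tsupport X
  · simp [h1.self_of_nhdsSet y hy]; ring
  · simp [image_eq_zero_of_notMem_tsupport hy]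

/-- The weak chain rule `∂_i (u²) = 2 u ∂_i u`. -/
theorem IsSobolev.integral_sq_mul_partialD {U : Set Plane} (hU : IsOpen U) {u : Plane → ℝ}
    {du : Fin 2 → Plane → ℝ} (h : IsSobolev U u du) {X : Plane → ℝ} (hX : ContDiff ℝ ∞ X)
    (hc : HasCompactSupport X) (hs : tsupport X ⊆ U) (i : Fin 2) :
    ∫ y, u y ^ 2 * partialD i X y = - ∫ y, 2 * (u y * du i y * X y) := by
  obtain ⟨χ, hχ, hcχ, hsχ, h1⟩ := exists_cutoff hU hc hs
  obtain ⟨K, hKU, hK, -, happ⟩ := h.exists_approx hU hχ hcχ hsχ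
  set g := fun y => χ y * u y with hg
  set g' := fun y => χ y * du i y + partialD i χ y * u y with hg'
  have hgX : ∀ y ∈ tsupport X, g y = u y ∧ g' y = du i y := fun y hy => by
    have e1 := h1.self_of_nhdsSet y hy
    have e2 := partialD_eq_zero_of_eventuallyEq_const (eventually_nhdsSet_iff_forall.1 h1 y hy) i
    simp [hg, hg', e1, e2]
  have e1 : ∀ y, u y ^ 2 * partialD i X y = g y ^ 2 * partialD i X y := fun y => by
    by_cases hy : y ∈ tsupport X
    · rw [(hgX y hy).1]
    · simp [image_eq_zero_of_notMem_tsupport fun h => hy (tsupport_partialD_subset X i h)]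
  have e2 : ∀ y, 2 * (u y * du i y * X y) = 2 * (g y * g' y * X y) := fun y => by
    by_cases hy : y ∈ tsupport X
    · rw [(hgX y hy).1, (hgX y hy).2]
    · simp [image_eq_zero_of_notMem_tsupport hy]
  simp_rw [e1, e2]
  have mg : MemLp g 2 volume :=
    memLp_mul_of_tsupport_subset h.locallyIntegrable h.sq hχ.continuous hcχ hsχ
  have mg' : MemLp g' 2 volume :=
    (memLp_mul_of_tsupport_subset (h.locallyIntegrable_deriv i) (h.sq_deriv i) hχ.continuous hcχ
      hsχ).add (memLp_mul_of_tsupport_subset h.locallyIntegrable h.sq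
        (contDiff_partialD hχ i).continuous (hasCompactSupport_partialD hcχ i)
        ((tsupport_partialD_subset χ i).trans hsχ))
  have mb : ∀ {f Y : Plane → ℝ}, MemLp f 2 volume → Continuous Y → HasCompactSupport Y →
      MemLp (fun y => f y * Y y) 2 volume := by
    intro f Y hf hY hcY
    obtain ⟨C, hC⟩ := hcY.exists_bound_of_continuous hY
    exact MemLp.of_le_mul (c := C) hf (hf.1.mul hY.aestronglyMeasurable) (ae_of_all _ fun y => by
      rw [norm_mul, mul_comm]; gcongr; exact hC y)
  have hdX := contDiff_partialD hX i
  have hcdX := hasCompactSupport_partialD hc i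
  -- The integrand g²∂X + 2gg'X equals ag + bg'. For smooth compactly supported `v` in place of g
  -- one has av + b∂v = g∂(vX) + g'vX, whose integral vanishes by the weak Leibniz rule.
  -- Approximating (g, g') by (v, ∂v) in L² therefore forces the integral of ag + bg' to vanish.
  set a := fun y => g y * partialD i X y + g' y * X y with ha
  set b := fun y => g y * X y with hb
  have ma : MemLp a 2 volume := (mb mg hdX.continuous hcdX).add (mb mg' hX.continuous hc)
  have mB : MemLp b 2 volume := mb mg hX.continuous hc
  have ia := (memLp_two_iff_integrable_sq ma.1).1 ma
  have ib := (memLp_two_iff_integrable_sq mB.1).1 mB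
  set H := ∫ y, (a y ^ 2 + b y ^ 2) with hH
  have i1 : Integrable fun y => g y ^ 2 * partialD i X y := by
    convert! mg.integrable_mul (mb mg hdX.continuous hcdX) using 1
    ext y; simp; ring
  have i2 : Integrable fun y => 2 * (g y * g' y * X y) := by
    convert! (mg.integrable_mul (mb mg' hX.continuous hc)).const_mul 2 using 1
    ext y; simp; ring
  -- The approximation errors are taken to be at most s² and Young's inequality is used with weights
  -- s and s⁻¹, giving sH + s⁻¹(s² + s²) = s(H + 2).
  have main : ∀ s > 0, |∫ y, (g y ^ 2 * partialD i X y + 2 * (g y * g' y * X y))|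
      ≤ s * (H + 2) := by
    intro s hs0
    obtain ⟨v, hv, hvK, ⟨iv, hv1⟩, hv2⟩ := happ (s ^ 2) (by positivity)
    obtain ⟨iv', hv2⟩ := hv2 i
    have hcv : HasCompactSupport v := hK.of_isClosed_subset (isClosed_tsupport _) hvK
    have hdv := contDiff_partialD hv i
    have hcdv := hasCompactSupport_partialD hcv i
    have hIBP := h.integral_mul_partialD hχ hcχ hsχ (hv.mul hX) i
    have hd : ∀ y, partialD i (fun y => v y * X y) y = v y * partialD i X y + partialD i v y * X y :=
      fun y => partialD_mul (hv.differentiable (by simp) y) (hX.differentiable (by simp) y) i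
    have lin : ∀ {f Y : Plane → ℝ}, MemLp f 2 volume → Continuous Y → HasCompactSupport Y →
        Integrable fun y => f y * Y y := fun hf hY hcY =>
      hf.integrable_mul (hY.memLp_of_hasCompactSupport (p := 2) hcY)
    have j1 : Integrable fun y => a y * v y := lin ma hv.continuous hcv
    have j2 : Integrable fun y => b y * partialD i v y := lin mB hdv.continuous hcdv
    have hz : ∫ y, (a y * v y + b y * partialD i v y) = 0 := by
      have k1 : Integrable fun y => g y * partialD i (fun y => v y * X y) y :=
        lin mg (contDiff_partialD (hv.mul hX) i).continuous
          (hasCompactSupport_partialD hcv.mul_right i)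
      have k2 : Integrable fun y => g' y * (v y * X y) :=
        lin mg' (hv.mul hX).continuous hcv.mul_right
      have : ∫ y, (g y * partialD i (fun y => v y * X y) y + g' y * (v y * X y)) = 0 := by
        rw [integral_add k1 k2]; linarith
      rw [← this]; congr 1; ext y; rw [hd]; simp only [ha, hb]; ring
    have e3 : ∫ y, (g y ^ 2 * partialD i X y + 2 * (g y * g' y * X y))
        = ∫ y, (a y * (g y - v y) + b y * (g' y - partialD i v y)) := by
      have := integral_sub (i1.add i2) (j1.add j2)
      simp only [Pi.add_apply] at this
      rw [hz, sub_zero] at this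
      rw [← this]; congr 1; ext y; simp only [ha, hb]; ring
    rw [e3]
    have bound : ∀ y, |a y * (g y - v y) + b y * (g' y - partialD i v y)| ≤
        s * (a y ^ 2 + b y ^ 2) + s⁻¹ * ((v y - g y) ^ 2 + (partialD i v y - g' y) ^ 2) := by
      intro y
      have am : ∀ p q : ℝ, |p * q| ≤ s * p ^ 2 + s⁻¹ * q ^ 2 := by
        intro p q
        have hss : s * s⁻¹ = 1 := mul_inv_cancel₀ hs0.ne'
        have hsi : 0 < s⁻¹ := inv_pos.2 hs0
        have e1 : 0 ≤ s * (|p| - s⁻¹ * |q|) ^ 2 := by positivity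
        have e2 : s * (|p| - s⁻¹ * |q|) ^ 2 = s * p ^ 2 + s⁻¹ * q ^ 2 - 2 * (|p| * |q|) := by
          rw [← sq_abs p, ← sq_abs q]
          linear_combination (-2 * |p| * |q| + s⁻¹ * |q| ^ 2) * hss
        rw [abs_mul]
        have : 0 ≤ |p| * |q| := by positivity
        linarith
      refine (abs_add_le _ _).trans ?_
      have := am (a y) (g y - v y)
      have := am (b y) (g' y - partialD i v y)
      rw [show (v y - g y) ^ 2 = (g y - v y) ^ 2 by ring,
        show (partialD i v y - g' y) ^ 2 = (g' y - partialD i v y) ^ 2 by ring]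
      linarith
    calc _ ≤ ∫ y, |a y * (g y - v y) + b y * (g' y - partialD i v y)| :=
          abs_integral_le_integral_abs
      _ ≤ ∫ y, (s * (a y ^ 2 + b y ^ 2)
            + s⁻¹ * ((v y - g y) ^ 2 + (partialD i v y - g' y) ^ 2)) := by
          refine integral_mono_of_nonneg (ae_of_all _ fun _ => abs_nonneg _) ?_ (ae_of_all _ bound)
          exact ((ia.add ib).const_mul _).add ((iv.add iv').const_mul _)
      _ = s * H + s⁻¹ * ((∫ y, (v y - g y) ^ 2) + ∫ y, (partialD i v y - g' y) ^ 2) := by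
          have I1 : Integrable fun y => s * (a y ^ 2 + b y ^ 2) := (ia.add ib).const_mul _
          have I2 : Integrable fun y => s⁻¹ * ((v y - g y) ^ 2 + (partialD i v y - g' y) ^ 2) :=
            (iv.add iv').const_mul _
          rw [integral_add I1 I2, integral_const_mul, integral_const_mul, integral_add iv iv']
      _ ≤ s * H + s⁻¹ * (s ^ 2 + s ^ 2) := by gcongr
      _ = s * (H + 2) := by field_simp; ring
  have hH0 : 0 ≤ H := integral_nonneg fun y => by positivity
  have zero : |∫ y, (g y ^ 2 * partialD i X y + 2 * (g y * g' y * X y))| ≤ 0 := by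
    refine le_of_forall_pos_le_add fun ε hε => ?_
    refine (main (ε / (H + 2)) (by positivity)).trans ?_
    rw [div_mul_cancel₀ _ (by positivity)]; linarith
  rw [integral_add i1 i2] at zero
  have := abs_nonpos_iff.1 zero
  linarith

/-! ### Dual norms in a basis. -/

section LinearAlgebra
variable {E : Type*} [NormedAddCommGroup E] [InnerProductSpace ℝ E]

/-- If `v` is the Riesz representative of `α` and `c` its coordinate vector in the basis, then α(b
i) = (Gc) i for the Gram matrix G, so c = G⁻¹(α(b ·)), while ‖α‖² = α(v) = ∑ c i α(b i). -/
theorem norm_sq_dual_eq_sum_gram_inv [CompleteSpace E] {ι : Type*} [Fintype ι] [DecidableEq ι]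
    {b : ι → E} (hb : LinearIndependent ℝ b) (hs : ⊤ ≤ Submodule.span ℝ (Set.range b))
    (α : E →L[ℝ] ℝ) :
    ‖α‖ ^ 2 = ∑ i, ∑ j, (Matrix.of fun i j => (inner ℝ (b i) (b j) : ℝ))⁻¹ i j * (α (b i) * α (b j)) := by
  set G : Matrix ι ι ℝ := Matrix.of fun i j => (inner ℝ (b i) (b j) : ℝ) with hG
  have hdet : IsUnit G.det := (Matrix.posDef_gram_of_linearIndependent hb).det_pos.ne'.isUnit
  set v := (InnerProductSpace.toDual ℝ E).symm α with hv
  have hα : ∀ x, α x = inner ℝ v x := fun x => InnerProductSpace.toDual_symm_apply.symm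
  obtain ⟨c, hc⟩ := (Submodule.mem_span_range_iff_exists_fun ℝ).1 (hs (Submodule.mem_top (x := v)))
  have h1 : (fun i => α (b i)) = G.mulVec c := by
    ext i
    rw [hα, ← hc, sum_inner, Matrix.mulVec, dotProduct]
    refine Finset.sum_congr rfl fun j _ => ?_
    rw [real_inner_smul_left, real_inner_comm]; simp [hG, mul_comm]
  have h2 : c = G⁻¹.mulVec fun i => α (b i) := by
    rw [h1, Matrix.mulVec_mulVec, Matrix.nonsing_inv_mul _ hdet, Matrix.one_mulVec]
  have h3 : ‖α‖ ^ 2 = α v := by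
    rw [hα, real_inner_self_eq_norm_sq, hv, LinearIsometryEquiv.norm_map]
  rw [h3, ← hc, map_sum]
  refine Finset.sum_congr rfl fun i _ => ?_
  rw [map_smul, smul_eq_mul]
  conv_lhs => rw [h2]
  rw [Matrix.mulVec, dotProduct, Finset.sum_mul]
  exact Finset.sum_congr rfl fun j _ => by ring

end LinearAlgebra

/-! ### Coordinate vector fields. -/

section Coord

instance finiteDimensional_tangentSpace {M : Type*} [TopologicalSpace M] [ChartedSpace Plane M]
    (p : M) : FiniteDimensional ℝ (TangentSpace (𝓡 2) p) :=
  inferInstanceAs (FiniteDimensional ℝ Plane)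

variable {M : Type*} [TopologicalSpace M] [ChartedSpace Plane M] [IsManifold (𝓡 2) ∞ M]
  {e : OpenPartialHomeomorph M Plane}

theorem contMDiffOn_symm_atlas (he : e ∈ atlas Plane M) :
    ContMDiffOn (𝓡 2) (𝓡 2) ∞ e.symm e.target :=
  contMDiffOn_symm_of_mem_maximalAtlas (IsManifold.subset_maximalAtlas he)

theorem contMDiffOn_atlas (he : e ∈ atlas Plane M) : ContMDiffOn (𝓡 2) (𝓡 2) ∞ e e.source :=
  contMDiffOn_of_mem_maximalAtlas (IsManifold.subset_maximalAtlas he)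

theorem mdifferentiableAt_symm (he : e ∈ atlas Plane M) {y : Plane} (hy : y ∈ e.target) :
    MDifferentiableAt (𝓡 2) (𝓡 2) e.symm y :=
  ((contMDiffOn_symm_atlas he).contMDiffAt (e.open_target.mem_nhds hy)).mdifferentiableAt (by simp)

/-- The coordinate field is the tangent map of the inverse chart applied to a constant field of the
plane. Its smoothness makes the metric coefficients smooth. -/
theorem contMDiffOn_coordVec (he : e ∈ atlas Plane M) (i : Fin 2) :
    ContMDiffOn 𝓘(ℝ, Plane) (𝓡 2).tangent ∞
      (fun y => (⟨e.symm y, coordVec e y i⟩ : TangentBundle (𝓡 2) M)) e.target := by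
  have h := (contMDiffOn_symm_atlas he).contMDiffOn_tangentMapWithin (m := ∞) (by simp)
    e.open_target.uniqueMDiffOn
  have h2 : ContMDiffOn 𝓘(ℝ, Plane) (𝓡 2).tangent ∞
      (fun y : Plane => (⟨y, (NormedSpace.fromTangentSpace (𝕜 := ℝ) y).symm
        (EuclideanSpace.single i (1 : ℝ))⟩ : TangentBundle 𝓘(ℝ, Plane) Plane)) e.target := by
    rw [contMDiffOn_vectorSpace_iff_contDiffOn]
    exact contDiffOn_const
  refine (h.comp h2 fun y hy => hy).congr fun y hy => ?_
  simp only [Function.comp, tangentMapWithin, coordVec]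
  rw [mfderivWithin_of_mem_nhds (e.open_target.mem_nhds hy)]

theorem linearIndependent_coordVec (he : e ∈ atlas Plane M) {y : Plane} (hy : y ∈ e.target) :
    LinearIndependent ℝ (coordVec e y) := by
  have hb := (EuclideanSpace.basisFun (Fin 2) ℝ).toBasis.linearIndependent
  let L := ((mdifferentiable_of_mem_atlas (I := 𝓡 2) he).symm.mfderiv (x := y) hy)
  have := hb.map' (((NormedSpace.fromTangentSpace (𝕜 := ℝ) y).symm.trans L).toLinearEquiv.toLinearMap)
    (LinearEquiv.ker _)
  convert! this using 1
  ext i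
  simp [coordVec, L]
  rfl

theorem span_coordVec (he : e ∈ atlas Plane M) {y : Plane} (hy : y ∈ e.target) :
    ⊤ ≤ Submodule.span ℝ (Set.range (coordVec e y)) := by
  have h := linearIndependent_coordVec he hy
  have : Module.finrank ℝ (TangentSpace (𝓡 2) (e.symm y)) = 2 :=
    (finrank_euclideanSpace_fin (𝕜 := ℝ) (n := 2))
  exact (h.span_eq_top_of_card_eq_finrank' (by simp [this])).ge

theorem mvfderiv_coordVec (he : e ∈ atlas Plane M) {y : Plane} (hy : y ∈ e.target) {f : M → ℝ}
    (hf : MDifferentiableAt (𝓡 2) 𝓘(ℝ, ℝ) f (e.symm y)) (i : Fin 2) :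
    mvfderiv (𝓡 2) f (e.symm y) (coordVec e y i) = partialD i (f ∘ e.symm) y := by
  have := mvfderiv_comp_apply (I := 𝓡 2) y hf (mdifferentiableAt_symm he hy)
    ((NormedSpace.fromTangentSpace (𝕜 := ℝ) y).symm (EuclideanSpace.single i (1 : ℝ)))
  rw [coordVec, ← this, partialD, mvfderiv, mfderiv_eq_fderiv]
  rfl

end Coord

/-! ### The metric and its volume density in charts. -/

section Metric
variable {M : Type*} [TopologicalSpace M] [ChartedSpace Plane M] [IsManifold (𝓡 2) ∞ M]
  [RiemannianBundle (fun p : M => TangentSpace (𝓡 2) p)]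
  {e : OpenPartialHomeomorph M Plane}

theorem metricMatrix_posDef (he : e ∈ atlas Plane M) {y : Plane} (hy : y ∈ e.target) :
    (metricMatrix e y).PosDef :=
  Matrix.posDef_gram_of_linearIndependent (linearIndependent_coordVec he hy)

theorem covecNormSq_eq_sum (he : e ∈ atlas Plane M) {y : Plane} (hy : y ∈ e.target)
    (α : TangentSpace (𝓡 2) (e.symm y) →L[ℝ] ℝ) :
    covecNormSq α = ∑ i, ∑ j, (metricMatrix e y)⁻¹ i j *
      (α (coordVec e y i) * α (coordVec e y j)) := by
  have : CompleteSpace (TangentSpace (𝓡 2) (e.symm y)) := FiniteDimensional.complete ℝ _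
  exact norm_sq_dual_eq_sum_gram_inv (linearIndependent_coordVec he hy) (span_coordVec he hy) α

theorem contDiffOn_metricMatrix
    [IsContMDiffRiemannianBundle (𝓡 2) ∞ Plane (fun p : M => TangentSpace (𝓡 2) p)]
    (he : e ∈ atlas Plane M) (i j : Fin 2) :
    ContDiffOn ℝ ∞ (fun y => metricMatrix e y i j) e.target := by
  rw [← contMDiffOn_iff_contDiffOn]
  exact (contMDiffOn_coordVec he i).inner_bundle (contMDiffOn_coordVec he j)

theorem volDensity_pos (he : e ∈ atlas Plane M) {y : Plane} (hy : y ∈ e.target) :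
    0 < volDensity e y := Real.sqrt_pos.2 (metricMatrix_posDef he hy).det_pos

section Smooth
variable [IsContMDiffRiemannianBundle (𝓡 2) ∞ Plane (fun p : M => TangentSpace (𝓡 2) p)]

theorem contDiffOn_det_metricMatrix (he : e ∈ atlas Plane M) :
    ContDiffOn ℝ ∞ (fun y => (metricMatrix e y).det) e.target := by
  simp only [Matrix.det_fin_two]
  exact ((contDiffOn_metricMatrix he 0 0).mul (contDiffOn_metricMatrix he 1 1)).sub
    ((contDiffOn_metricMatrix he 0 1).mul (contDiffOn_metricMatrix he 1 0))

theorem contDiffOn_volDensity (he : e ∈ atlas Plane M) :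
    ContDiffOn ℝ ∞ (volDensity e) e.target :=
  (contDiffOn_det_metricMatrix he).sqrt fun _ hy => (metricMatrix_posDef he hy).det_pos.ne'

theorem contDiffOn_inv_metricMatrix (he : e ∈ atlas Plane M) (i j : Fin 2) :
    ContDiffOn ℝ ∞ (fun y => (metricMatrix e y)⁻¹ i j) e.target := by
  have h : ∀ y, (metricMatrix e y)⁻¹ i j
      = (metricMatrix e y).det⁻¹ * (metricMatrix e y).adjugate i j := fun y => by
    rw [Matrix.inv_def, Matrix.smul_apply, Ring.inverse_eq_inv', smul_eq_mul]
  simp_rw [h, Matrix.adjugate_fin_two]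
  refine ((contDiffOn_det_metricMatrix he).inv
    fun _ hy => (metricMatrix_posDef he hy).det_pos.ne').mul ?_
  fin_cases i <;> fin_cases j <;> simp
  exacts [contDiffOn_metricMatrix he 1 1, (contDiffOn_metricMatrix he 0 1).neg,
    (contDiffOn_metricMatrix he 1 0).neg, contDiffOn_metricMatrix he 0 0]

end Smooth

section Transition
variable {e' : OpenPartialHomeomorph M Plane}

/-- The coordinate vector field of a chart, as a vector of the model space. -/
noncomputable def coordVecModel (e : OpenPartialHomeomorph M Plane) (y : Plane) (i : Fin 2) : Plane :=
  coordVec e y i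

-- The chain rule for `e.symm`, which near `y` is `e'.symm` composed with the transition map. The
-- base points `e.symm y` and `e'.symm (e' (e.symm y))` are equal but not definitionally so, hence
-- the comparison takes place in the model space.
omit [RiemannianBundle (fun p : M => TangentSpace (𝓡 2) p)] in
theorem coordVec_transition (he : e ∈ atlas Plane M) (he' : e' ∈ atlas Plane M) {y : Plane}
    (hy : y ∈ e.target) (hy' : e.symm y ∈ e'.source) (i : Fin 2) :
    DifferentiableAt ℝ (e' ∘ e.symm) y ∧
    coordVecModel e y i = ∑ k, (fderiv ℝ (e' ∘ e.symm) y (EuclideanSpace.single i 1)) k •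
      coordVecModel e' (e' (e.symm y)) k := by
  have hF : MDifferentiableAt (𝓡 2) (𝓡 2) (e' ∘ e.symm) y :=
    (((contMDiffOn_atlas he').contMDiffAt (e'.open_source.mem_nhds hy')).mdifferentiableAt
      (by simp)).comp y (mdifferentiableAt_symm he hy)
  have hF' : DifferentiableAt ℝ (e' ∘ e.symm) y := hF.differentiableAt
  have h1 := (mdifferentiableAt_symm he' (e'.map_source hy')).hasMFDerivAt
  have h2 := hF'.hasFDerivAt.hasMFDerivAt
  have h3 := HasMFDerivAt.comp y h1 h2
  have hev : e.symm =ᶠ[𝓝 y] e'.symm ∘ (e' ∘ e.symm) := by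
    filter_upwards [(e.isOpen_inter_preimage_symm e'.open_source).mem_nhds ⟨hy, hy'⟩] with z hz
    simp [e'.left_inv hz.2]
  have h4 : mfderiv (𝓡 2) (𝓡 2) e.symm y = _ := (h3.congr_of_eventuallyEq hev).mfderiv
  refine ⟨hF', ?_⟩
  have h5 : fderiv ℝ (e' ∘ e.symm) y (EuclideanSpace.single i 1)
      = ∑ k, (fderiv ℝ (e' ∘ e.symm) y (EuclideanSpace.single i 1)) k •
        EuclideanSpace.single k (1 : ℝ) := by
    ext j; fin_cases j <;> simp
  let A : Plane →L[ℝ] Plane := mfderiv (𝓡 2) (𝓡 2) e'.symm (e' (e.symm y))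
  have h6 : coordVecModel e y i
      = A (fderiv ℝ (e' ∘ e.symm) y (EuclideanSpace.single i 1)) := by
    rw [coordVecModel, coordVec, h4]; rfl
  rw [h6]
  conv_lhs => rw [h5]
  rw [map_sum]
  refine Finset.sum_congr rfl fun k _ => ?_
  rw [map_smul]; rfl

/-- The Riemannian metric, on tangent vectors given by their coordinates in the model space. -/
noncomputable def metricAt (p : M) (v w : Plane) : ℝ :=
  inner ℝ (show TangentSpace (𝓡 2) p from v) (show TangentSpace (𝓡 2) p from w)

omit [IsManifold (𝓡 2) ∞ M] in
theorem metricAt_sum (p : M) (a b : Fin 2 → ℝ) (v w : Fin 2 → Plane) :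
    metricAt p (∑ k, a k • v k) (∑ l, b l • w l)
      = ∑ k, ∑ l, a k * b l * metricAt p (v k) (w l) := by
  have h := sum_inner (𝕜 := ℝ) Finset.univ
    (fun k => a k • (show TangentSpace (𝓡 2) p from v k))
    (∑ l, b l • (show TangentSpace (𝓡 2) p from w l))
  refine h.trans (Finset.sum_congr rfl fun k _ => ?_)
  rw [inner_sum]
  refine Finset.sum_congr rfl fun l _ => ?_
  rw [real_inner_smul_left, real_inner_smul_right, mul_assoc]
  rfl

theorem metricMatrix_transition (he : e ∈ atlas Plane M) (he' : e' ∈ atlas Plane M) {y : Plane}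
    (hy : y ∈ e.target) (hy' : e.symm y ∈ e'.source) :
    metricMatrix e y
      = (Matrix.of fun k i => (fderiv ℝ (e' ∘ e.symm) y (EuclideanSpace.single i 1)) k).transpose
        * metricMatrix e' (e' (e.symm y))
        * Matrix.of fun k i => (fderiv ℝ (e' ∘ e.symm) y (EuclideanSpace.single i 1)) k := by
  ext i j
  have h1 : metricMatrix e y i j = metricAt (e.symm y) (coordVecModel e y i) (coordVecModel e y j) := rfl
  have h2 : ∀ k l, metricMatrix e' (e' (e.symm y)) k l = metricAt (e.symm y)
      (coordVecModel e' (e' (e.symm y)) k) (coordVecModel e' (e' (e.symm y)) l) := fun k l => by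
    have : metricMatrix e' (e' (e.symm y)) k l = metricAt (e'.symm (e' (e.symm y)))
      (coordVecModel e' (e' (e.symm y)) k) (coordVecModel e' (e' (e.symm y)) l) := rfl
    rw [this]
    congr 1
    exact e'.left_inv hy'
  rw [h1, (coordVec_transition he he' hy hy' i).2, (coordVec_transition he he' hy hy' j).2,
    metricAt_sum]
  simp only [Matrix.mul_apply, Matrix.transpose_apply, Matrix.of_apply, h2, Fin.sum_univ_two]
  ring

/-- Determinants of G = Jᵀ G' J, with J the Jacobian matrix of the transition map, followed by
square roots. -/
theorem volDensity_transition (he : e ∈ atlas Plane M) (he' : e' ∈ atlas Plane M) {y : Plane}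
    (hy : y ∈ e.target) (hy' : e.symm y ∈ e'.source) :
    volDensity e y
      = |(fderiv ℝ (e' ∘ e.symm) y).det| * volDensity e' (e' (e.symm y)) := by
  have hd : (fderiv ℝ (e' ∘ e.symm) y).det = (Matrix.of fun k i =>
      (fderiv ℝ (e' ∘ e.symm) y (EuclideanSpace.single i 1)) k).det := by
    rw [ContinuousLinearMap.det, ← LinearMap.det_toMatrix (EuclideanSpace.basisFun (Fin 2) ℝ).toBasis]
    congr 1
  rw [volDensity, metricMatrix_transition he he' hy hy', Matrix.det_mul, Matrix.det_mul,
    Matrix.det_transpose, ← hd, volDensity, ← Real.sqrt_sq_eq_abs, ← Real.sqrt_mul (sq_nonneg _)]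
  congr 1; ring

end Transition
end Metric

/-! ### The Riemannian volume measure. -/

section Volume
variable {M : Type*} [TopologicalSpace M] [ChartedSpace Plane M] [IsManifold (𝓡 2) ∞ M]
  [RiemannianBundle (fun p : M => TangentSpace (𝓡 2) p)]
  [IsContMDiffRiemannianBundle (𝓡 2) ∞ Plane (fun p : M => TangentSpace (𝓡 2) p)]
  [MeasurableSpace M] [BorelSpace M] {e e' : OpenPartialHomeomorph M Plane}

theorem measurableSet_target_inter_preimage {s : Set M} (hs : MeasurableSet s) :
    MeasurableSet (e.target ∩ e.symm ⁻¹' s) := by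
  have h : Measurable (e.target.domRestrict e.symm) :=
    (continuousOn_iff_continuous_domRestrict.1 e.continuousOn_symm).measurable
  have := MeasurableSet.subtype_image e.open_target.measurableSet (h hs)
  convert! this using 1
  ext y
  simp [and_comm]

theorem aemeasurable_volDensity (he : e ∈ atlas Plane M) :
    AEMeasurable (fun y => ENNReal.ofReal (volDensity e y)) (volume.restrict e.target) :=
  ((contDiffOn_volDensity he).continuousOn.aemeasurable e.open_target.measurableSet).ennreal_ofReal

theorem aemeasurable_symm (ρ : Plane → ℝ≥0∞) :
    AEMeasurable e.symm ((volume.restrict e.target).withDensity ρ) :=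
  (e.continuousOn_symm.aemeasurable e.open_target.measurableSet).mono_ac
    (withDensity_absolutelyContinuous _ _)

theorem chartVolume_apply {s : Set M} (hs : MeasurableSet s) :
    chartVolume e s = ∫⁻ y in e.target ∩ e.symm ⁻¹' s, ENNReal.ofReal (volDensity e y) := by
  rw [chartVolume, Measure.map_apply_of_aemeasurable (aemeasurable_symm _) hs, withDensity_apply',
    Measure.restrict_restrict₀', inter_comm]
  exact e.open_target.measurableSet.nullMeasurableSet

/-- The change of variables formula for the transition map: its Jacobian determinant is exactly the
factor relating the two densities. -/
theorem chartVolume_eq_of_subset (he : e ∈ atlas Plane M) (he' : e' ∈ atlas Plane M) {s : Set M}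
    (hs : MeasurableSet s) (h1 : s ⊆ e.source) (h2 : s ⊆ e'.source) :
    chartVolume e s = chartVolume e' s := by
  rw [chartVolume_apply hs, chartVolume_apply hs]
  set S := e.target ∩ e.symm ⁻¹' s with hS
  have himg : e'.target ∩ e'.symm ⁻¹' s = (e' ∘ e.symm) '' S := by
    ext z
    constructor
    · rintro ⟨hz, hzs⟩
      exact ⟨e (e'.symm z), ⟨e.map_source (h1 hzs), by simpa [e.left_inv (h1 hzs)] using hzs⟩,
        by simp [e.left_inv (h1 hzs), e'.right_inv hz]⟩
    · rintro ⟨y, ⟨hy, hys⟩, rfl⟩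
      exact ⟨e'.map_source (h2 hys), by simpa [e'.left_inv (h2 hys)] using hys⟩
  have hinj : InjOn (e' ∘ e.symm) S := fun y hy z hz h =>
    e.symm.injOn hy.1 hz.1 (e'.injOn (h2 hy.2) (h2 hz.2) h)
  have hd : ∀ y ∈ S, HasFDerivWithinAt (e' ∘ e.symm) (fderiv ℝ (e' ∘ e.symm) y) S y :=
    fun y hy => (coordVec_transition he he' hy.1 (h2 hy.2) 0).1.hasFDerivAt.hasFDerivWithinAt
  rw [himg, lintegral_image_eq_lintegral_abs_det_fderiv_mul volume
    (measurableSet_target_inter_preimage hs) hd hinj]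
  refine setLIntegral_congr_fun (measurableSet_target_inter_preimage hs) fun y hy => ?_
  simp only [volDensity_transition he he' hy.1 (h2 hy.2), Function.comp]
  rw [ENNReal.ofReal_mul (abs_nonneg _)]

theorem chartVolume_inter_source {s : Set M} (hs : MeasurableSet s) :
    chartVolume e (s ∩ e.source) = chartVolume e s := by
  rw [chartVolume_apply hs, chartVolume_apply (hs.inter e.open_source.measurableSet)]
  congr 2
  ext y
  simp only [mem_inter_iff, mem_preimage]
  exact ⟨fun h => ⟨h.1, h.2.1⟩, fun h => ⟨h.1, h.2, e.map_target h.1⟩⟩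

/-- The measure `chartVolume e + (riemVolume M).restrict e.sourceᶜ` dominates every chart measure:
inside `e.source` another chart measure is bounded by `chartVolume e` because they agree on
overlaps, and outside it is bounded by the supremum. It therefore dominates the supremum as well,
and its second summand vanishes on subsets of `e.source`. -/
theorem riemVolume_restrict_source (he : e ∈ atlas Plane M) :
    (riemVolume M).restrict e.source = chartVolume e := by
  have hm := e.open_source.measurableSet
  have hle : chartVolume e ≤ riemVolume M := le_biSup (fun e => chartVolume e) he
  refine le_antisymm (Measure.le_iff.2 fun s hs => ?_) (Measure.le_iff.2 fun s hs => ?_)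
  · have hsup : riemVolume M ≤ chartVolume e + (riemVolume M).restrict e.sourceᶜ := by
      refine iSup₂_le fun e' he' => Measure.le_iff.2 fun t ht => ?_
      rw [Measure.add_apply, Measure.restrict_apply ht, ← measure_inter_add_sdiff t hm]
      have hle' : chartVolume e' ≤ riemVolume M := le_biSup (fun e => chartVolume e) he'
      refine add_le_add ?_ (hle' _)
      rw [← chartVolume_inter_source (ht.inter hm),
        chartVolume_eq_of_subset he' he ((ht.inter hm).inter e'.open_source.measurableSet)
          inter_subset_right (inter_subset_left.trans inter_subset_right)]
      exact measure_mono (inter_subset_left.trans inter_subset_left)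
    rw [Measure.restrict_apply hs]
    refine (hsup _).trans ?_
    rw [Measure.add_apply, Measure.restrict_apply (hs.inter hm), inter_assoc, inter_compl_self,
      inter_empty, measure_empty, add_zero]
    exact measure_mono inter_subset_left
  · rw [Measure.restrict_apply hs, ← chartVolume_inter_source hs]
    exact hle _

/-- Outside its target the inverse chart is uncontrolled. On the subtype `e.target` it is an open
embedding, and integrals against the image measure can then be transferred for arbitrary functions,
without measurability assumptions. -/
theorem chartVolume_eq_map_subtype :
    chartVolume e = Measure.map (e.target.domRestrict e.symm)
      (Measure.comap Subtype.val
        ((volume.restrict e.target).withDensity fun y => ENNReal.ofReal (volDensity e y))) := by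
  have hm := e.open_target.measurableSet
  have h : Measurable (e.target.domRestrict e.symm) :=
    (continuousOn_iff_continuous_domRestrict.1 e.continuousOn_symm).measurable
  have hr : ((volume.restrict e.target).withDensity fun y => ENNReal.ofReal (volDensity e y))
      = Measure.map Subtype.val (Measure.comap (Subtype.val : e.target → Plane)
        ((volume.restrict e.target).withDensity fun y => ENNReal.ofReal (volDensity e y))) := by
    rw [map_comap_subtype_coe hm, restrict_withDensity hm, Measure.restrict_restrict hm, inter_self]
  have ha := aemeasurable_symm (e := e) fun y => ENNReal.ofReal (volDensity e y)
  rw [hr] at ha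
  rw [chartVolume]
  conv_lhs => rw [hr]
  rw [ha.map_map_of_aemeasurable measurable_subtype_coe.aemeasurable]
  rfl

theorem measurableEmbedding_restrict_symm : MeasurableEmbedding (e.target.domRestrict e.symm) := by
  exact e.symm.isOpenEmbedding_restrict.measurableEmbedding

theorem integral_eq_integral_chart (he : e ∈ atlas Plane M) {h : M → ℝ}
    (hs : Function.support h ⊆ e.source) :
    ∫ p, h p ∂riemVolume M = ∫ y in e.target, volDensity e y * h (e.symm y) := by
  have hm := e.open_target.measurableSet
  rw [← setIntegral_eq_integral_of_forall_compl_eq_zero (s := e.source)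
    (fun p hp => by_contra fun hne => hp (hs hne)), riemVolume_restrict_source he,
    chartVolume_eq_map_subtype, measurableEmbedding_restrict_symm.integral_map]
  have := integral_subtype_comap (μ := (volume.restrict e.target).withDensity
    fun y => ENNReal.ofReal (volDensity e y)) hm (fun y => h (e.symm y))
  refine this.trans ?_
  rw [restrict_withDensity hm, Measure.restrict_restrict hm, inter_self,
    integral_withDensity_eq_integral_toReal_smul₀ (aemeasurable_volDensity he)
      (ae_of_all _ fun _ => ENNReal.ofReal_lt_top)]
  refine setIntegral_congr_fun hm fun y hy => ?_
  simp [ENNReal.toReal_ofReal (volDensity_pos he hy).le]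

theorem integrable_iff_integrableOn_chart (he : e ∈ atlas Plane M) {h : M → ℝ}
    (hs : Function.support h ⊆ e.source) :
    Integrable h (riemVolume M) ↔
      IntegrableOn (fun y => volDensity e y * h (e.symm y)) e.target := by
  have hm := e.open_target.measurableSet
  rw [← integrableOn_iff_integrable_of_support_subset hs, IntegrableOn,
    riemVolume_restrict_source he, chartVolume_eq_map_subtype,
    measurableEmbedding_restrict_symm.integrable_map_iff]
  have := integrableOn_iff_comap_subtypeVal (μ := (volume.restrict e.target).withDensity
    fun y => ENNReal.ofReal (volDensity e y)) (f := fun y => h (e.symm y)) hm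
  refine this.symm.trans ?_
  rw [IntegrableOn, restrict_withDensity hm, Measure.restrict_restrict hm, inter_self,
    integrable_withDensity_iff_integrable_smul₀' (aemeasurable_volDensity he)
      (ae_of_all _ fun _ => ENNReal.ofReal_lt_top)]
  refine integrableOn_congr_fun (fun y hy => ?_) hm
  simp [ENNReal.toReal_ofReal (volDensity_pos he hy).le]

theorem integrableOn_image_iff (he : e ∈ atlas Plane M) {h : M → ℝ} {A : Set Plane}
    (hA : MeasurableSet A) (hAt : A ⊆ e.target) (hA' : MeasurableSet (e.symm '' A)) :
    IntegrableOn h (e.symm '' A) (riemVolume M) ↔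
      IntegrableOn (fun y => volDensity e y * h (e.symm y)) A := by
  have hsub : e.symm '' A ⊆ e.source := by
    rintro _ ⟨y, hy, rfl⟩; exact e.map_target (hAt hy)
  rw [← integrable_indicator_iff hA', integrable_iff_integrableOn_chart he
    (support_indicator_subset.trans hsub)]
  rw [← integrable_indicator_iff hA, ← integrableOn_iff_integrable_of_support_subset
    (support_indicator_subset.trans hAt)]
  refine integrableOn_congr_fun (fun y hy => ?_) e.open_target.measurableSet
  have : e.symm y ∈ e.symm '' A ↔ y ∈ A :=
    ⟨fun ⟨z, hz, hzy⟩ => e.symm.injOn (hAt hz) hy hzy ▸ hz, fun h => mem_image_of_mem _ h⟩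
  by_cases hyA : y ∈ A
  · simp [indicator, hyA, this.2 hyA]
  · rw [indicator_of_notMem hyA, indicator_of_notMem (fun h => hyA (this.1 h)), mul_zero]

theorem isCompact_symm_image {K : Set Plane} (hK : IsCompact K) (h : K ⊆ e.target) :
    IsCompact (e.symm '' K) := hK.image_of_continuousOn (e.continuousOn_symm.mono h)

instance isLocallyFiniteMeasure_riemVolume [T2Space M] :
    IsLocallyFiniteMeasure (riemVolume M) := by
  refine ⟨fun p => ?_⟩
  set e := chartAt Plane p with he
  have hea : e ∈ atlas Plane M := chart_mem_atlas _ _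
  obtain ⟨K, hK, hpK, hKt⟩ := exists_compact_subset e.open_target
    (e.map_source (mem_chart_source Plane p))
  have hKc := isCompact_symm_image hK hKt
  refine ⟨e.symm '' K, ?_, ?_⟩
  · have : e.symm '' interior K ∈ 𝓝 p := by
      refine (e.isOpen_image_symm_of_subset_target isOpen_interior
        (interior_subset.trans hKt)).mem_nhds ⟨e p, hpK, e.left_inv (mem_chart_source Plane p)⟩
    exact mem_of_superset this (image_mono interior_subset)
  -- Finiteness of the volume of a compact set is read off from the integrability of the constant 1,
  -- which in the chart is that of the continuous density.
  · have h1 : IntegrableOn (fun _ : M => (1 : ℝ)) (e.symm '' K) (riemVolume M) := by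
      rw [integrableOn_image_iff hea hK.measurableSet hKt hKc.measurableSet]
      simp only [mul_one]
      exact ((contDiffOn_volDensity hea).continuousOn.mono hKt).integrableOn_compact hK
    rw [integrableOn_const_iff] at h1
    simpa using h1

end Volume

/-! ### Extension by zero, and integration by parts in a chart. -/

theorem contDiff_indicator_of_compact {U K : Set Plane} (hU : IsOpen U) (hK : IsCompact K)
    (hKU : K ⊆ U) {g : Plane → ℝ} (hg : ContDiffOn ℝ ∞ g U) (h0 : ∀ y ∈ U, y ∉ K → g y = 0) :
    ContDiff ℝ ∞ (U.indicator g) ∧ HasCompactSupport (U.indicator g) ∧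
      tsupport (U.indicator g) ⊆ K := by
  have hs : tsupport (U.indicator g) ⊆ K := by
    refine closure_minimal (fun y hy => ?_) hK.isClosed
    by_contra hyK
    refine hy ?_
    by_cases hyU : y ∈ U
    · rw [indicator_of_mem hyU, h0 y hyU hyK]
    · exact indicator_of_notMem hyU _
  refine ⟨contDiff_iff_contDiffAt.2 fun y => ?_, hK.of_isClosed_subset (isClosed_tsupport _) hs, hs⟩
  by_cases hy : y ∈ U
  · refine (hg.contDiffAt (hU.mem_nhds hy)).congr_of_eventuallyEq ?_
    filter_upwards [hU.mem_nhds hy] with z hz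
    exact indicator_of_mem hz _
  · have : U.indicator g =ᶠ[𝓝 y] fun _ => 0 :=
      notMem_tsupport_iff_eventuallyEq.1 fun h => hy (hKU (hs h))
    exact contDiffAt_const.congr_of_eventuallyEq this

theorem partialD_congr {a b : Plane → ℝ} {y : Plane} (h : a =ᶠ[𝓝 y] b) (i : Fin 2) :
    partialD i a y = partialD i b y := by simp [partialD, h.fderiv_eq]

theorem partialD_indicator {U : Set Plane} (hU : IsOpen U) {y : Plane} (hy : y ∈ U)
    (g : Plane → ℝ) (i : Fin 2) : partialD i (U.indicator g) y = partialD i g y :=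
  partialD_congr (by filter_upwards [hU.mem_nhds hy] with z hz using indicator_of_mem hz _) i

theorem contDiffOn_partialD {U : Set Plane} (hU : IsOpen U) {g : Plane → ℝ}
    (hg : ContDiffOn ℝ ∞ g U) (i : Fin 2) : ContDiffOn ℝ ∞ (partialD i g) U :=
  (hg.fderiv_of_isOpen hU (m := ∞) (by simp)).clm_apply contDiffOn_const

theorem partialD_add {a b : Plane → ℝ} {y : Plane} (ha : DifferentiableAt ℝ a y)
    (hb : DifferentiableAt ℝ b y) (i : Fin 2) :
    partialD i (fun z => a z + b z) y = partialD i a y + partialD i b y := by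
  simp only [partialD]
  rw [fderiv_fun_add ha hb]
  simp

theorem integral_mul_partialD_eq_neg {φ g : Plane → ℝ} {U : Set Plane} (hU : IsOpen U)
    (hφ : ContDiff ℝ ∞ φ) (hc : HasCompactSupport φ) (hs : tsupport φ ⊆ U)
    (hg : ContDiffOn ℝ ∞ g U) (i : Fin 2) :
    Integrable (fun y => φ y * partialD i g y) ∧ Integrable (fun y => partialD i φ y * g y) ∧
    ∫ y, φ y * partialD i g y = - ∫ y, partialD i φ y * g y := by
  have int : ∀ {a b : Plane → ℝ}, Continuous a → tsupport a ⊆ tsupport φ → ContinuousOn b U →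
      Integrable fun y => a y * b y := by
    intro a b ha hsa hb
    rw [← integrableOn_iff_integrable_of_support_subset (s := tsupport φ)
      ((Function.support_mul_subset_left _ _).trans ((subset_tsupport _).trans hsa))]
    exact (ha.continuousOn.mul (hb.mono hs)).integrableOn_compact hc
  have i1 := int hφ.continuous subset_rfl (contDiffOn_partialD hU hg i).continuousOn
  have i2 := int (contDiff_partialD hφ i).continuous (tsupport_partialD_subset φ i)
    hg.continuousOn
  refine ⟨i1, i2, ?_⟩
  exact integral_mul_fderiv_eq_neg_fderiv_mul_of_integrable i2 i1
    (int hφ.continuous subset_rfl hg.continuousOn)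
    (fun y _ => hφ.differentiable (by simp) y)
    (fun y hy => (hg.contDiffAt (hU.mem_nhds (hs hy))).differentiableAt (by simp))

section Pull
variable {M : Type*} [TopologicalSpace M] [ChartedSpace Plane M] [IsManifold (𝓡 2) ∞ M]
  {e : OpenPartialHomeomorph M Plane}

/-- A function on the plane, pulled back to `M` by the chart `e` and extended by zero. -/
noncomputable def pull (e : OpenPartialHomeomorph M Plane) (φ : Plane → ℝ) : M → ℝ :=
  e.source.indicator (φ ∘ e)

theorem pull_symm {y : Plane} (hy : y ∈ e.target) (φ : Plane → ℝ) : pull e φ (e.symm y) = φ y := by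
  simp [pull, e.map_target hy, e.right_inv hy]

theorem isOpen_coordDomain {Ω : Set M} (hΩ : IsOpen Ω) : IsOpen (coordDomain e Ω) :=
  e.isOpen_inter_preimage_symm hΩ

/-- The support of the extension lies in the image of `tsupport φ`. This image is compact, hence
closed in the Hausdorff space `M`, and sits inside the chart domain, so the extension by zero stays
smooth across the boundary of the chart. -/
theorem isTest_pull [T2Space M] (he : e ∈ atlas Plane M) {Ω : Set M} {φ : Plane → ℝ}
    (hφ : ContDiff ℝ ∞ φ) (hc : HasCompactSupport φ) (hs : tsupport φ ⊆ coordDomain e Ω) :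
    IsTest (Ω ∩ e.source) (pull e φ) := by
  have hKt : tsupport φ ⊆ e.target := hs.trans inter_subset_left
  have hK : IsCompact (e.symm '' tsupport φ) :=
    IsCompact.image_of_continuousOn hc (e.continuousOn_symm.mono hKt)
  have hsub : tsupport (pull e φ) ⊆ e.symm '' tsupport φ := by
    refine closure_minimal (fun p hp => ?_) hK.isClosed
    have hpe : p ∈ e.source := support_indicator_subset hp
    have : φ (e p) ≠ 0 := by simpa [pull, hpe] using hp
    exact ⟨e p, subset_tsupport _ this, e.left_inv hpe⟩
  have hsrc : e.symm '' tsupport φ ⊆ Ω ∩ e.source := by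
    rintro _ ⟨y, hy, rfl⟩
    exact ⟨(hs hy).2, e.map_target (hKt hy)⟩
  refine ⟨contMDiff_of_tsupport fun p hp => ?_, hK.of_isClosed_subset (isClosed_tsupport _) hsub,
    hsub.trans hsrc⟩
  have hpe : p ∈ e.source := (hsrc (hsub hp)).2
  have h1 : ContMDiffAt (𝓡 2) 𝓘(ℝ, ℝ) ∞ (φ ∘ e) p :=
    (hφ.contMDiff.contMDiffAt).comp p
      ((contMDiffOn_atlas he).contMDiffAt (e.open_source.mem_nhds hpe))
  refine h1.congr_of_eventuallyEq ?_
  filter_upwards [e.open_source.mem_nhds hpe] with q hq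
  exact indicator_of_mem hq _

theorem contDiffOn_comp_symm (he : e ∈ atlas Plane M) {f : M → ℝ}
    (hf : ContMDiff (𝓡 2) 𝓘(ℝ, ℝ) ∞ f) : ContDiffOn ℝ ∞ (f ∘ e.symm) e.target := by
  rw [← contMDiffOn_iff_contDiffOn]
  exact hf.comp_contMDiffOn (contMDiffOn_symm_atlas he)

theorem push_spec (he : e ∈ atlas Plane M) {Ω : Set M} {ψ : M → ℝ} (hψ : IsTest Ω ψ)
    (hs : tsupport ψ ⊆ e.source) :
    ContDiff ℝ ∞ (e.target.indicator (ψ ∘ e.symm)) ∧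
    HasCompactSupport (e.target.indicator (ψ ∘ e.symm)) ∧
    tsupport (e.target.indicator (ψ ∘ e.symm)) ⊆ e '' tsupport ψ ∧
    IsCompact (e '' tsupport ψ) ∧ e '' tsupport ψ ⊆ coordDomain e Ω := by
  have hK : IsCompact (e '' tsupport ψ) :=
    IsCompact.image_of_continuousOn hψ.compact (e.continuousOn.mono hs)
  have hKt : e '' tsupport ψ ⊆ coordDomain e Ω := by
    rintro _ ⟨p, hp, rfl⟩
    exact ⟨e.map_source (hs hp), by simpa [e.left_inv (hs hp)] using hψ.subset hp⟩
  have := contDiff_indicator_of_compact e.open_target hK (hKt.trans inter_subset_left)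
    (contDiffOn_comp_symm he hψ.smooth) (fun y hy hyK => by
      by_contra h
      exact hyK ⟨e.symm y, subset_tsupport _ h, e.right_inv hy⟩)
  exact ⟨this.1, this.2.1, this.2.2, hK, hKt⟩

end Pull

/-! ### The inner product of covectors. -/

section Inner
variable {M : Type*} [TopologicalSpace M] [ChartedSpace Plane M]
  [RiemannianBundle (fun p : M => TangentSpace (𝓡 2) p)]

instance completeSpace_tangentSpace (p : M) : CompleteSpace (TangentSpace (𝓡 2) p) :=
  FiniteDimensional.complete ℝ _

/-- The inner product of covectors induced by the Riemannian metric. -/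
noncomputable def covecInner {p : M} (α β : TangentSpace (𝓡 2) p →L[ℝ] ℝ) : ℝ :=
  inner ℝ ((InnerProductSpace.toDual ℝ (TangentSpace (𝓡 2) p)).symm α)
    ((InnerProductSpace.toDual ℝ (TangentSpace (𝓡 2) p)).symm β)

theorem covecNormSq_eq_inner {p : M} (α : TangentSpace (𝓡 2) p →L[ℝ] ℝ) :
    covecNormSq α = covecInner α α := by
  rw [covecInner, real_inner_self_eq_norm_sq, LinearIsometryEquiv.norm_map, covecNormSq]

theorem covecInner_add_left {p : M} (α β γ : TangentSpace (𝓡 2) p →L[ℝ] ℝ) :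
    covecInner (α + β) γ = covecInner α γ + covecInner β γ := by
  simp [covecInner, inner_add_left]

theorem covecInner_add_right {p : M} (α β γ : TangentSpace (𝓡 2) p →L[ℝ] ℝ) :
    covecInner α (β + γ) = covecInner α β + covecInner α γ := by
  simp [covecInner, inner_add_right]

theorem covecInner_smul_left {p : M} (c : ℝ) (α β : TangentSpace (𝓡 2) p →L[ℝ] ℝ) :
    covecInner (c • α) β = c * covecInner α β := by
  simp [covecInner, real_inner_smul_left]

theorem covecInner_smul_right {p : M} (c : ℝ) (α β : TangentSpace (𝓡 2) p →L[ℝ] ℝ) :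
    covecInner α (c • β) = c * covecInner α β := by
  simp [covecInner]

theorem covecInner_zero_left {p : M} (β : TangentSpace (𝓡 2) p →L[ℝ] ℝ) :
    covecInner 0 β = 0 := by
  simp [covecInner]

theorem mvfderiv_eq_zero_of_notMem_tsupport {M : Type*} [TopologicalSpace M] [ChartedSpace Plane M]
    {ψ : M → ℝ} {p : M} (h : p ∉ tsupport ψ) : mvfderiv (𝓡 2) ψ p = 0 := by
  have h0 : ψ =ᶠ[𝓝 p] fun _ => 0 := notMem_tsupport_iff_eventuallyEq.1 h
  have h1 := ((hasMFDerivAt_const (I := 𝓡 2) (I' := 𝓘(ℝ, ℝ)) (0 : ℝ) p).congr_of_eventuallyEq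
    h0).mfderiv
  ext v
  exact DFunLike.congr_fun h1 v

theorem covecInner_comm {p : M} (α β : TangentSpace (𝓡 2) p →L[ℝ] ℝ) :
    covecInner α β = covecInner β α := real_inner_comm _ _

theorem covecNormSq_nonneg {p : M} (α : TangentSpace (𝓡 2) p →L[ℝ] ℝ) : 0 ≤ covecNormSq α :=
  sq_nonneg _

theorem covecNormSq_add {p : M} (α β : TangentSpace (𝓡 2) p →L[ℝ] ℝ) :
    covecNormSq (α + β) = covecNormSq α + 2 * covecInner α β + covecNormSq β := by
  simp only [covecNormSq_eq_inner, covecInner_add_left, covecInner_add_right, covecInner_comm β α]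
  ring

theorem covecNormSq_smul {p : M} (c : ℝ) (α : TangentSpace (𝓡 2) p →L[ℝ] ℝ) :
    covecNormSq (c • α) = c ^ 2 * covecNormSq α := by
  simp only [covecNormSq_eq_inner, covecInner_smul_left, covecInner_smul_right]
  ring

/-- Polarization of the coordinate formula for the squared norm; the symmetry of the inverse metric
matrix merges the two cross terms. -/
theorem covecInner_eq_sum [IsManifold (𝓡 2) ∞ M] {e : OpenPartialHomeomorph M Plane}
    (he : e ∈ atlas Plane M) {y : Plane} (hy : y ∈ e.target)
    (α β : TangentSpace (𝓡 2) (e.symm y) →L[ℝ] ℝ) :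
    covecInner α β = ∑ i, ∑ j, (metricMatrix e y)⁻¹ i j *
      (α (coordVec e y i) * β (coordVec e y j)) := by
  have h1 := covecNormSq_add α β
  rw [covecNormSq_eq_sum he hy, covecNormSq_eq_sum he hy, covecNormSq_eq_sum he hy] at h1
  have hsymm : (metricMatrix e y)⁻¹ 0 1 = (metricMatrix e y)⁻¹ 1 0 := by
    have := (metricMatrix_posDef he hy).isHermitian.inv
    simpa using (this.apply 0 1).symm
  simp only [Fin.sum_univ_two, add_apply, hsymm] at h1 ⊢
  linarith

end Inner

/-! ### The Laplace–Beltrami operator: Green's formula and chart independence. -/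

section Laplace
variable {M : Type*} [TopologicalSpace M] [ChartedSpace Plane M] [IsManifold (𝓡 2) ∞ M]
  [RiemannianBundle (fun p : M => TangentSpace (𝓡 2) p)]
  {e e' : OpenPartialHomeomorph M Plane}

/-- The components `√(det g) ∑_j g^{ij} ∂_j f` of the gradient density of `f` in the chart `e`. -/
noncomputable def gradDensity (e : OpenPartialHomeomorph M Plane) (f : M → ℝ) (i : Fin 2)
    (y : Plane) : ℝ :=
  volDensity e y * ∑ j, (metricMatrix e y)⁻¹ i j * partialD j (f ∘ e.symm) y

/-- The divergence `∑_i ∂_i (√(det g) ∑_j g^{ij} ∂_j f)` in the chart `e`. -/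
noncomputable def divGrad (e : OpenPartialHomeomorph M Plane) (f : M → ℝ) (y : Plane) : ℝ :=
  ∑ i, partialD i (gradDensity e f i) y

theorem laplaceBeltrami_def (f : M → ℝ) (p : M) :
    laplaceBeltrami f p = (volDensity (chartAt Plane p) (chartAt Plane p p))⁻¹ *
      divGrad (chartAt Plane p) f (chartAt Plane p p) := rfl

theorem gradDensity_congr {f g : M → ℝ} {y : Plane} (h : f ∘ e.symm =ᶠ[𝓝 y] g ∘ e.symm)
    (i : Fin 2) : gradDensity e f i y = gradDensity e g i y := by
  simp only [gradDensity, partialD_congr h]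

theorem divGrad_congr {f g : M → ℝ} {y : Plane} (h : f ∘ e.symm =ᶠ[𝓝 y] g ∘ e.symm) :
    divGrad e f y = divGrad e g y := by
  refine Finset.sum_congr rfl fun i _ => partialD_congr ?_ i
  filter_upwards [eventually_eventually_nhds.2 h] with z hz using gradDensity_congr hz i

/-- This identity turns the coordinate expressions produced by integration by parts into the
chart-free pairing of covectors times the volume density. -/
theorem sum_mvfderiv_mul_gradDensity (he : e ∈ atlas Plane M) {y : Plane} (hy : y ∈ e.target)
    (α : TangentSpace (𝓡 2) (e.symm y) →L[ℝ] ℝ) {f : M → ℝ}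
    (hf : MDifferentiableAt (𝓡 2) 𝓘(ℝ, ℝ) f (e.symm y)) :
    ∑ i, α (coordVec e y i) * gradDensity e f i y
      = volDensity e y * covecInner α (mvfderiv (𝓡 2) f (e.symm y)) := by
  rw [covecInner_eq_sum he hy]
  simp only [mvfderiv_coordVec he hy hf, gradDensity, Finset.mul_sum]
  exact Finset.sum_congr rfl fun i _ => Finset.sum_congr rfl fun j _ => by ring

section Smooth
variable [IsContMDiffRiemannianBundle (𝓡 2) ∞ Plane (fun p : M => TangentSpace (𝓡 2) p)]

theorem contDiffOn_gradDensity (he : e ∈ atlas Plane M) {f : M → ℝ}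
    (hf : ContMDiff (𝓡 2) 𝓘(ℝ, ℝ) ∞ f) (i : Fin 2) :
    ContDiffOn ℝ ∞ (gradDensity e f i) e.target := by
  refine (contDiffOn_volDensity he).mul (ContDiffOn.sum fun j _ => ?_)
  exact (contDiffOn_inv_metricMatrix he i j).mul
    (contDiffOn_partialD e.open_target (contDiffOn_comp_symm he hf) j)

theorem contDiffOn_divGrad (he : e ∈ atlas Plane M) {f : M → ℝ}
    (hf : ContMDiff (𝓡 2) 𝓘(ℝ, ℝ) ∞ f) : ContDiffOn ℝ ∞ (divGrad e f) e.target :=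
  ContDiffOn.sum fun i _ => contDiffOn_partialD e.open_target (contDiffOn_gradDensity he hf i) i

variable [MeasurableSpace M] [BorelSpace M]

/-- Green's formula in a chart. -/
theorem integral_mul_divGrad_eq (he : e ∈ atlas Plane M) {f : M → ℝ}
    (hf : ContMDiff (𝓡 2) 𝓘(ℝ, ℝ) ∞ f) {φ : Plane → ℝ} (hφ : ContDiff ℝ ∞ φ)
    (hc : HasCompactSupport φ) (hs : tsupport φ ⊆ e.target) {ψ : M → ℝ}
    (hψ : ContMDiff (𝓡 2) 𝓘(ℝ, ℝ) ∞ ψ) (hψφ : ∀ y ∈ e.target, ψ (e.symm y) = φ y)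
    (hψs : tsupport ψ ⊆ e.source) :
    ∫ y, φ y * divGrad e f y
      = - ∫ p, covecInner (mvfderiv (𝓡 2) ψ p) (mvfderiv (𝓡 2) f p) ∂riemVolume M := by
  have h := fun i => integral_mul_partialD_eq_neg e.open_target hφ hc hs
    (contDiffOn_gradDensity he hf i) i
  have h1 : ∫ y, φ y * divGrad e f y = - ∫ y, ∑ i, partialD i φ y * gradDensity e f i y := by
    simp only [divGrad, Finset.mul_sum]
    rw [integral_finsetSum _ fun i _ => (h i).1, integral_finsetSum _ fun i _ => (h i).2.1,
      ← Finset.sum_neg_distrib]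
    exact Finset.sum_congr rfl fun i _ => (h i).2.2
  have hsupp : Function.support
      (fun p => covecInner (mvfderiv (𝓡 2) ψ p) (mvfderiv (𝓡 2) f p)) ⊆ e.source := by
    intro p hp
    by_contra hpe
    refine hp ?_
    change covecInner _ _ = 0
    rw [mvfderiv_eq_zero_of_notMem_tsupport fun h => hpe (hψs h), covecInner_zero_left]
  rw [h1, integral_eq_integral_chart he hsupp, ← setIntegral_eq_integral_of_forall_compl_eq_zero
    (s := e.target)]
  · congr 1
    refine setIntegral_congr_fun e.open_target.measurableSet fun y hy => ?_
    have hd : ∀ {g : M → ℝ}, ContMDiff (𝓡 2) 𝓘(ℝ, ℝ) ∞ g →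
        MDifferentiableAt (𝓡 2) 𝓘(ℝ, ℝ) g (e.symm y) := fun hg =>
      hg.mdifferentiable (by simp) _
    rw [← sum_mvfderiv_mul_gradDensity he hy _ (hd hf)]
    refine Finset.sum_congr rfl fun i _ => ?_
    rw [mvfderiv_coordVec he hy (hd hψ)]
    congr 1
    refine partialD_congr ?_ i
    filter_upwards [e.open_target.mem_nhds hy] with z hz
    exact (hψφ z hz).symm
  · intro y hy
    refine Finset.sum_eq_zero fun i _ => ?_
    rw [image_eq_zero_of_notMem_tsupport fun h => hy (hs (tsupport_partialD_subset φ i h)), zero_mul]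

/-- The Laplace-Beltrami operator can be computed in any chart. -/
theorem inv_volDensity_mul_divGrad_eq [T2Space M] (he : e ∈ atlas Plane M)
    (he' : e' ∈ atlas Plane M) {f : M → ℝ} (hf : ContMDiff (𝓡 2) 𝓘(ℝ, ℝ) ∞ f) {p : M}
    (hp : p ∈ e.source) (hp' : p ∈ e'.source) :
    (volDensity e (e p))⁻¹ * divGrad e f (e p) = (volDensity e' (e' p))⁻¹ * divGrad e' f (e' p) := by
  set O := coordDomain e e'.source with hO
  have hOo : IsOpen O := isOpen_coordDomain e'.open_source
  -- `L` is the difference of the two expressions for the Laplacian, multiplied by the density of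
  -- `e`. Green's formula in either chart reduces the integral against a test function to the same
  -- chart-free Dirichlet pairing, so `L` is orthogonal to all test functions on the overlap. Being
  -- continuous, it vanishes there.
  set L : Plane → ℝ := fun y => divGrad e f y - volDensity e y *
    ((volDensity e' (e' (e.symm y)))⁻¹ * divGrad e' f (e' (e.symm y))) with hL
  have hLc : ContinuousOn L O := by
    have hF : ContinuousOn (fun y => e' (e.symm y)) O :=
      e'.continuousOn.comp (e.continuousOn_symm.mono inter_subset_left) fun y hy => hy.2
    have hmaps : MapsTo (fun y => e' (e.symm y)) O e'.target := fun y hy => e'.map_source hy.2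
    refine ((contDiffOn_divGrad he hf).continuousOn.mono inter_subset_left).sub
      (((contDiffOn_volDensity he).continuousOn.mono inter_subset_left).mul
      (ContinuousOn.mul (ContinuousOn.inv₀
        ((contDiffOn_volDensity he').continuousOn.comp hF hmaps) ?_)
        ((contDiffOn_divGrad he' hf).continuousOn.comp hF hmaps)))
    exact fun y hy => (volDensity_pos he' (hmaps hy)).ne'
  have hz : ∀ φ : Plane → ℝ, ContDiff ℝ ∞ φ → HasCompactSupport φ → tsupport φ ⊆ O →
      ∫ y, φ y • L y = 0 := by
    intro φ hφ hc hs
    have hT := isTest_pull he (Ω := e'.source) hφ hc hs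
    have h1 := integral_mul_divGrad_eq he hf hφ hc (hs.trans inter_subset_left) hT.smooth
      (fun y hy => pull_symm hy φ) (hT.subset.trans inter_subset_right)
    obtain ⟨q1, q2, q3, q4, q5⟩ := push_spec he' hT (hT.subset.trans inter_subset_left)
    set φ' := e'.target.indicator (pull e φ ∘ e'.symm) with hφ'
    have h2 := integral_mul_divGrad_eq he' hf q1 q2 (q3.trans (q5.trans inter_subset_left))
      hT.smooth (fun y hy => by rw [hφ', indicator_of_mem hy]; rfl)
      (hT.subset.trans inter_subset_left)
    have h12 : ∫ y, φ y * divGrad e f y = ∫ y, φ' y * divGrad e' f y := h1.trans h2.symm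
    -- Integrating `H` over `M` in each of the two charts moves the expression computed in `e'` back
    -- to the coordinates of `e`.
    let H : M → ℝ := fun p =>
      pull e φ p * ((volDensity e' (e' p))⁻¹ * divGrad e' f (e' p))
    have hH : Function.support H ⊆ tsupport (pull e φ) :=
      (Function.support_mul_subset_left _ _).trans (subset_tsupport _)
    have h3 := integral_eq_integral_chart he (h := H)
      (hH.trans (hT.subset.trans inter_subset_right))
    have h4 := integral_eq_integral_chart he' (h := H)
      (hH.trans (hT.subset.trans inter_subset_left))
    have h5 : ∫ y in e'.target, volDensity e' y * H (e'.symm y) = ∫ y, φ' y * divGrad e' f y := by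
      refine Eq.trans ?_ (setIntegral_eq_integral_of_forall_compl_eq_zero (s := e'.target)
        (fun y hy => by rw [hφ', indicator_of_notMem hy, zero_mul]))
      refine setIntegral_congr_fun e'.open_target.measurableSet fun y hy => ?_
      simp only [H, e'.right_inv hy, hφ', indicator_of_mem hy, Function.comp]
      have := (volDensity_pos he' hy).ne'
      field_simp
    have hz' : ∀ y ∉ e.target, φ y = 0 := fun y hy =>
      image_eq_zero_of_notMem_tsupport fun h => hy (hs h).1
    have h6 : ∫ y in e.target, volDensity e y * H (e.symm y)
        = ∫ y, φ y * (volDensity e y *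
          ((volDensity e' (e' (e.symm y)))⁻¹ * divGrad e' f (e' (e.symm y)))) := by
      refine Eq.trans ?_ (setIntegral_eq_integral_of_forall_compl_eq_zero (s := e.target)
        (fun y hy => by rw [hz' y hy, zero_mul]))
      refine setIntegral_congr_fun e.open_target.measurableSet fun y hy => ?_
      simp only [H, pull_symm hy]
      ring
    have i1 : Integrable fun y => φ y * divGrad e f y := by
      rw [← integrableOn_iff_integrable_of_support_subset (s := tsupport φ)
        ((Function.support_mul_subset_left _ _).trans (subset_tsupport _))]
      exact (hφ.continuous.continuousOn.mul ((contDiffOn_divGrad he hf).continuousOn.mono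
        (hs.trans inter_subset_left))).integrableOn_compact hc
    have i2 : Integrable fun y => φ y * L y := by
      rw [← integrableOn_iff_integrable_of_support_subset (s := tsupport φ)
        ((Function.support_mul_subset_left _ _).trans (subset_tsupport _))]
      exact (hφ.continuous.continuousOn.mul (hLc.mono hs)).integrableOn_compact hc
    have h7 := integral_sub i1 i2
    have h8 : ∀ y, φ y * divGrad e f y - φ y * L y = φ y * (volDensity e y *
          ((volDensity e' (e' (e.symm y)))⁻¹ * divGrad e' f (e' (e.symm y)))) := fun y => by
      simp only [hL]; ring
    simp only [h8] at h7
    rw [← h6, ← h3, h4, h5, ← h12] at h7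
    simp only [smul_eq_mul]
    linarith
  have hae := hOo.ae_eq_zero_of_integral_contDiff_smul_eq_zero
    (hLc.locallyIntegrableOn hOo.measurableSet) hz
  have hpO : e p ∈ O := ⟨e.map_source hp, by simpa [e.left_inv hp] using hp'⟩
  have hzero : EqOn L (fun _ => 0) O :=
    Measure.eqOn_open_of_ae_eq ((ae_restrict_iff' hOo.measurableSet).2 hae) hOo hLc
      continuousOn_const
  have := hzero hpO
  simp only [hL, e.left_inv hp] at this
  rw [sub_eq_zero.1 this, inv_mul_cancel_left₀ (volDensity_pos he (e.map_source hp)).ne']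

theorem laplaceBeltrami_eq [T2Space M] (he : e ∈ atlas Plane M) {f : M → ℝ}
    (hf : ContMDiff (𝓡 2) 𝓘(ℝ, ℝ) ∞ f) {p : M} (hp : p ∈ e.source) :
    laplaceBeltrami f p = (volDensity e (e p))⁻¹ * divGrad e f (e p) :=
  inv_volDensity_mul_divGrad_eq (chart_mem_atlas _ _) he hf (mem_chart_source _ _) hp

theorem continuous_laplaceBeltrami [T2Space M] {f : M → ℝ} (hf : ContMDiff (𝓡 2) 𝓘(ℝ, ℝ) ∞ f) :
    Continuous (laplaceBeltrami f) := by
  refine continuous_iff_continuousAt.2 fun p => ?_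
  set e := chartAt Plane p
  have he : e ∈ atlas Plane M := chart_mem_atlas _ _
  have hp : e.source ∈ 𝓝 p := e.open_source.mem_nhds (mem_chart_source _ _)
  have h : ContinuousOn (fun q => (volDensity e (e q))⁻¹ * divGrad e f (e q)) e.source :=
    ((((contDiffOn_volDensity he).continuousOn.comp e.continuousOn e.mapsTo).inv₀
      fun q hq => (volDensity_pos he (e.map_source hq)).ne')).mul
      ((contDiffOn_divGrad he hf).continuousOn.comp e.continuousOn e.mapsTo)
  refine (h.continuousAt hp).congr ?_
  filter_upwards [hp] with q hq using (laplaceBeltrami_eq he hf hq).symm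

end Smooth
end Laplace

/-! ### Calculus of test functions on the surface. -/

section Calculus
variable {M : Type*} [TopologicalSpace M] [ChartedSpace Plane M] [IsManifold (𝓡 2) ∞ M]

theorem mvfderiv_mul_apply {f g : M → ℝ} (hf : ContMDiff (𝓡 2) 𝓘(ℝ, ℝ) ∞ f)
    (hg : ContMDiff (𝓡 2) 𝓘(ℝ, ℝ) ∞ g) (p : M) :
    mvfderiv (𝓡 2) (fun q => f q * g q) p
      = f p • mvfderiv (𝓡 2) g p + g p • mvfderiv (𝓡 2) f p :=
  mvfderiv_mul (hf.mdifferentiable (by simp) p) (hg.mdifferentiable (by simp) p)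

theorem IsTest.mul_right {Ω : Set M} {f g : M → ℝ} (hf : IsTest Ω f)
    (hg : ContMDiff (𝓡 2) 𝓘(ℝ, ℝ) ∞ g) : IsTest Ω (fun p => f p * g p) :=
  ⟨hf.smooth.mul hg, hf.compact.mul_right, tsupport_mul_subset_left.trans hf.subset⟩

theorem IsTest.add {Ω : Set M} {f g : M → ℝ} (hf : IsTest Ω f) (hg : IsTest Ω g) :
    IsTest Ω (fun p => f p + g p) :=
  ⟨hf.smooth.add hg.smooth, hf.compact.add hg.compact,
    (tsupport_add f g).trans (union_subset hf.subset hg.subset)⟩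

theorem isTest_zero (Ω : Set M) : IsTest Ω (fun _ : M => (0 : ℝ)) :=
  ⟨contMDiff_const, HasCompactSupport.zero, by
    rw [show tsupport (fun _ : M => (0 : ℝ)) = ∅ from tsupport_eq_empty_iff.2 rfl]
    exact empty_subset _⟩

theorem IsTest.sum {Ω : Set M} {ι : Type*} (s : Finset ι) {f : ι → M → ℝ}
    (hf : ∀ i ∈ s, IsTest Ω (f i)) : IsTest Ω (fun p => ∑ i ∈ s, f i p) := by
  classical
  induction s using Finset.induction_on with
  | empty => simpa using isTest_zero Ω
  | insert a s ha ih =>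
    simp only [Finset.sum_insert ha]
    exact (hf a (Finset.mem_insert_self _ _)).add
      (ih fun i hi => hf i (Finset.mem_insert_of_mem hi))

/-- A test function is a finite sum of test functions supported in chart domains. -/
theorem IsTest.exists_sum_chart [T2Space M] [SecondCountableTopology M] {Ω : Set M} {ψ : M → ℝ}
    (hψ : IsTest Ω ψ) : ∃ (s : Finset M) (Ψ : M → M → ℝ), (∀ i, IsTest Ω (Ψ i)) ∧
      (∀ i, tsupport (Ψ i) ⊆ (chartAt Plane i).source) ∧ ∀ p, ψ p = ∑ i ∈ s, Ψ i p := by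
  have : LocallyCompactSpace M := ChartedSpace.locallyCompactSpace Plane M
  obtain ⟨f, hf⟩ := SmoothPartitionOfUnity.exists_isSubordinate_chartAt_source (𝓡 2) M
  have hfin := f.locallyFinite.finite_nonempty_inter_compact hψ.compact
  refine ⟨hfin.toFinset, fun i p => ψ p * f i p, fun i => hψ.mul_right (f i).contMDiff,
    fun i => (tsupport_mul_subset_right).trans (hf i), fun p => ?_⟩
  rw [← Finset.mul_sum]
  by_cases hp : ψ p = 0
  · simp [hp]
  · have h1 := f.sum_eq_one (mem_univ p)
    rw [finsum_eq_sum_of_support_subset _ (s := hfin.toFinset)] at h1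
    · rw [h1, mul_one]
    · intro i hi
      simp only [Finite.coe_toFinset, mem_ofPred_eq]
      exact ⟨p, hi, subset_tsupport _ hp⟩

variable [RiemannianBundle (fun p : M => TangentSpace (𝓡 2) p)]

theorem gradSq_eq_sum {e : OpenPartialHomeomorph M Plane} (he : e ∈ atlas Plane M) {y : Plane}
    (hy : y ∈ e.target) {f : M → ℝ} (hf : ContMDiff (𝓡 2) 𝓘(ℝ, ℝ) ∞ f) :
    gradSq f (e.symm y) = ∑ i, ∑ j, (metricMatrix e y)⁻¹ i j *
      (partialD i (f ∘ e.symm) y * partialD j (f ∘ e.symm) y) := by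
  rw [gradSq, covecNormSq_eq_sum he hy]
  simp only [mvfderiv_coordVec he hy (hf.mdifferentiable (by simp) _)]

theorem gradSq_eq_zero_of_notMem_tsupport {f : M → ℝ} {p : M} (h : p ∉ tsupport f) :
    gradSq f p = 0 := by
  rw [gradSq, mvfderiv_eq_zero_of_notMem_tsupport h, covecNormSq_eq_inner, covecInner_zero_left]

theorem laplaceBeltrami_eq_zero_of_notMem_tsupport {f : M → ℝ} {p : M} (h : p ∉ tsupport f) :
    laplaceBeltrami f p = 0 := by
  set e := chartAt Plane p with he
  have hp : p ∈ e.source := mem_chart_source _ _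
  have h0 : f ∘ e.symm =ᶠ[𝓝 (e p)] (fun _ : M => (0 : ℝ)) ∘ e.symm := by
    have h1 : Tendsto e.symm (𝓝 (e p)) (𝓝 p) := e.tendsto_symm hp
    exact (notMem_tsupport_iff_eventuallyEq.1 h).comp_tendsto h1
  rw [laplaceBeltrami_def, ← he, divGrad_congr h0]
  have : ∀ i, gradDensity e (fun _ : M => (0 : ℝ)) i = fun _ => 0 := fun i => by
    funext y
    have : ∀ j, partialD j ((fun _ : M => (0 : ℝ)) ∘ e.symm) y = 0 := fun j =>
      partialD_eq_zero_of_eventuallyEq_const (c := 0) (Eventually.of_forall fun _ => rfl) j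
    simp [gradDensity, this]
  simp [divGrad, this, partialD_eq_zero_of_eventuallyEq_const (c := 0)
    (Eventually.of_forall fun _ => rfl)]

variable [IsContMDiffRiemannianBundle (𝓡 2) ∞ Plane (fun p : M => TangentSpace (𝓡 2) p)]

theorem continuous_gradSq {f : M → ℝ} (hf : ContMDiff (𝓡 2) 𝓘(ℝ, ℝ) ∞ f) :
    Continuous (gradSq f) := by
  refine continuous_iff_continuousAt.2 fun p => ?_
  set e := chartAt Plane p
  have he : e ∈ atlas Plane M := chart_mem_atlas _ _
  have hp : e.source ∈ 𝓝 p := e.open_source.mem_nhds (mem_chart_source _ _)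
  have hd := fun i => (contDiffOn_partialD e.open_target (contDiffOn_comp_symm he hf) i).continuousOn
  have h : ContinuousOn (fun y => ∑ i, ∑ j, (metricMatrix e y)⁻¹ i j *
      (partialD i (f ∘ e.symm) y * partialD j (f ∘ e.symm) y)) e.target :=
    continuousOn_finsetSum _ fun i _ => continuousOn_finsetSum _ fun j _ =>
      (contDiffOn_inv_metricMatrix he i j).continuousOn.mul ((hd i).mul (hd j))
  refine ((h.comp e.continuousOn e.mapsTo).continuousAt hp).congr ?_
  filter_upwards [hp] with q hq
  have := gradSq_eq_sum he (e.map_source hq) hf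
  rw [e.left_inv hq] at this
  exact this.symm

theorem laplaceBeltrami_add {f g : M → ℝ} (hf : ContMDiff (𝓡 2) 𝓘(ℝ, ℝ) ∞ f)
    (hg : ContMDiff (𝓡 2) 𝓘(ℝ, ℝ) ∞ g) (p : M) :
    laplaceBeltrami (fun q => f q + g q) p = laplaceBeltrami f p + laplaceBeltrami g p := by
  simp only [laplaceBeltrami_def]
  set e := chartAt Plane p
  have he : e ∈ atlas Plane M := chart_mem_atlas _ _
  have hp : e p ∈ e.target := e.map_source (mem_chart_source _ _)
  have d : ∀ {h : Plane → ℝ} {y : Plane}, y ∈ e.target → ContDiffOn ℝ ∞ h e.target →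
      DifferentiableAt ℝ h y := fun hy hh =>
    (hh.contDiffAt (e.open_target.mem_nhds hy)).differentiableAt (by simp)
  have h1 : ∀ i, ∀ y ∈ e.target, gradDensity e (fun q => f q + g q) i y
      = gradDensity e f i y + gradDensity e g i y := fun i y hy => by
    have : ∀ j, partialD j ((fun q => f q + g q) ∘ e.symm) y
        = partialD j (f ∘ e.symm) y + partialD j (g ∘ e.symm) y := fun j =>
      partialD_add (d hy (contDiffOn_comp_symm he hf)) (d hy (contDiffOn_comp_symm he hg)) j
    simp only [gradDensity, this, mul_add, Finset.sum_add_distrib]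
  rw [← mul_add]
  congr 1
  simp only [divGrad, ← Finset.sum_add_distrib]
  refine Finset.sum_congr rfl fun i _ => ?_
  rw [← partialD_add (d hp (contDiffOn_gradDensity he hf i)) (d hp (contDiffOn_gradDensity he hg i))]
  refine partialD_congr ?_ i
  filter_upwards [e.open_target.mem_nhds hp] with y hy using h1 i y hy

theorem laplaceBeltrami_sum {ι : Type*} (s : Finset ι) {f : ι → M → ℝ} {Ω : Set M}
    (hf : ∀ i ∈ s, IsTest Ω (f i)) (p : M) :
    laplaceBeltrami (fun q => ∑ i ∈ s, f i q) p = ∑ i ∈ s, laplaceBeltrami (f i) p := by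
  classical
  induction s using Finset.induction_on with
  | empty =>
    simp only [Finset.sum_empty]
    refine laplaceBeltrami_eq_zero_of_notMem_tsupport ?_
    rw [show tsupport (fun _ : M => (0 : ℝ)) = ∅ from tsupport_eq_empty_iff.2 rfl]
    exact notMem_empty _
  | insert a s ha ih =>
    have hs : ∀ i ∈ s, IsTest Ω (f i) := fun i hi => hf i (Finset.mem_insert_of_mem hi)
    simp only [Finset.sum_insert ha]
    rw [laplaceBeltrami_add (hf a (Finset.mem_insert_self _ _)).smooth (IsTest.sum s hs).smooth,
      ih hs]

/-- The gradient density of f² is 2f times that of f. The product rule for its divergence produces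
2fΔf, together with the pairing of df with the gradient density, which is |∇f|² up to the volume
factor. -/
theorem laplaceBeltrami_sq {f : M → ℝ} (hf : ContMDiff (𝓡 2) 𝓘(ℝ, ℝ) ∞ f) (p : M) :
    laplaceBeltrami (fun q => f q * f q) p = 2 * gradSq f p + 2 * (f p * laplaceBeltrami f p) := by
  simp only [laplaceBeltrami_def]
  set e := chartAt Plane p
  have he : e ∈ atlas Plane M := chart_mem_atlas _ _
  have hps : p ∈ e.source := mem_chart_source _ _
  have hp : e p ∈ e.target := e.map_source hps
  have d : ∀ {h : Plane → ℝ} {y : Plane}, y ∈ e.target → ContDiffOn ℝ ∞ h e.target →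
      DifferentiableAt ℝ h y := fun hy hh =>
    (hh.contDiffAt (e.open_target.mem_nhds hy)).differentiableAt (by simp)
  have hf' := contDiffOn_comp_symm he hf
  have h1 : ∀ i, ∀ y ∈ e.target, gradDensity e (fun q => f q * f q) i y
      = (2 * (f ∘ e.symm) y) * gradDensity e f i y := fun i y hy => by
    have : ∀ j, partialD j ((fun q => f q * f q) ∘ e.symm) y
        = 2 * (f ∘ e.symm) y * partialD j (f ∘ e.symm) y := fun j => by
      refine (partialD_mul (d hy hf') (d hy hf') j).trans ?_
      ring
    simp only [gradDensity, this, Finset.mul_sum]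
    exact Finset.sum_congr rfl fun j _ => by ring
  have h2 : ∀ i, partialD i (gradDensity e (fun q => f q * f q) i) (e p)
      = 2 * f p * partialD i (gradDensity e f i) (e p)
        + 2 * (partialD i (f ∘ e.symm) (e p) * gradDensity e f i (e p)) := fun i => by
    have hc : DifferentiableAt ℝ (fun y => 2 * (f ∘ e.symm) y) (e p) :=
      (d hp hf').const_mul 2
    rw [partialD_congr (b := fun y => (2 * (f ∘ e.symm) y) * gradDensity e f i y)
      (by filter_upwards [e.open_target.mem_nhds hp] with y hy using h1 i y hy) i,
      partialD_mul hc (d hp (contDiffOn_gradDensity he hf i))]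
    have : partialD i (fun y => 2 * (f ∘ e.symm) y) (e p) = 2 * partialD i (f ∘ e.symm) (e p) := by
      simp only [partialD]
      rw [fderiv_const_mul (d hp hf')]
      simp
    rw [this]
    simp only [Function.comp, e.left_inv hps]
    ring
  have hg : gradSq f p = (volDensity e (e p))⁻¹ *
      ∑ i, partialD i (f ∘ e.symm) (e p) * gradDensity e f i (e p) := by
    have h := gradSq_eq_sum he hp hf
    rw [e.left_inv hps] at h
    rw [h, Finset.mul_sum]
    refine Finset.sum_congr rfl fun i _ => ?_
    have := (volDensity_pos he hp).ne'
    simp only [gradDensity, Finset.mul_sum]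
    exact Finset.sum_congr rfl fun j _ => by field_simp
  simp only [divGrad, h2, hg, Finset.sum_add_distrib, ← Finset.mul_sum]
  ring

end Calculus

/-! ### The weak chain rule for a weight. -/

section Weight
variable {M : Type*} [TopologicalSpace M] [T2Space M] [ChartedSpace Plane M]
  [IsManifold (𝓡 2) ∞ M]
  [RiemannianBundle (fun p : M => TangentSpace (𝓡 2) p)]
  [IsContMDiffRiemannianBundle (𝓡 2) ∞ Plane (fun p : M => TangentSpace (𝓡 2) p)]
  [MeasurableSpace M] [BorelSpace M] {e : OpenPartialHomeomorph M Plane}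
  {Ω : Set M} {κ w : M → ℝ} {dw : ∀ p : M, TangentSpace (𝓡 2) p →L[ℝ] ℝ}

theorem locallyIntegrableOn_comp_symm (he : e ∈ atlas Plane M) (hΩ : IsOpen Ω) {h : M → ℝ}
    (hh : LocallyIntegrableOn h Ω (riemVolume M)) :
    LocallyIntegrableOn (fun y => h (e.symm y)) (coordDomain e Ω) := by
  rw [locallyIntegrableOn_iff (isOpen_coordDomain hΩ).isLocallyClosed]
  intro K hKs hK
  have hKt : K ⊆ e.target := hKs.trans inter_subset_left
  have hKi := isCompact_symm_image hK hKt
  have h1 : IntegrableOn h (e.symm '' K) (riemVolume M) :=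
    hh.integrableOn_compact_subset (by rintro _ ⟨y, hy, rfl⟩; exact (hKs hy).2) hKi
  rw [integrableOn_image_iff he hK.measurableSet hKt hKi.measurableSet] at h1
  have hc : ContinuousOn (fun y => (volDensity e y)⁻¹) K :=
    ((contDiffOn_volDensity he).continuousOn.mono hKt).inv₀
      fun y hy => (volDensity_pos he (hKt hy)).ne'
  refine (h1.continuousOn_mul hc hK).congr_fun (fun y hy => ?_) hK.measurableSet
  have := (volDensity_pos he (hKt hy)).ne'
  field_simp

theorem sq_apply_coordVec_le {y : Plane} (α : TangentSpace (𝓡 2) (e.symm y) →L[ℝ] ℝ) (i : Fin 2) :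
    α (coordVec e y i) ^ 2 ≤ covecNormSq α * metricMatrix e y i i := by
  have h1 := α.le_opNorm (coordVec e y i)
  have h2 : metricMatrix e y i i = ‖coordVec e y i‖ ^ 2 := real_inner_self_eq_norm_sq (coordVec e y i)
  rw [h2, covecNormSq, ← mul_pow, ← sq_abs, ← Real.norm_eq_abs]
  gcongr

/-- By Cauchy–Schwarz the squared components of dw are at most |dw|² g_ii, and g_ii is bounded on
compact sets, so the invariant integrability of |dw|² yields that of the components. -/
theorem IsWeight.isSobolev (he : e ∈ atlas Plane M) (hΩ : IsOpen Ω) (hw : IsWeight Ω κ w dw) :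
    IsSobolev (coordDomain e Ω) (fun y => w (e.symm y))
      (fun i y => dw (e.symm y) (coordVec e y i)) where
  locallyIntegrable := hw.weakDifferential.locallyIntegrable e he
  sq := locallyIntegrableOn_comp_symm he hΩ hw.sq_integrable
  locallyIntegrable_deriv := hw.weakDifferential.locallyIntegrable_component e he
  sq_deriv i := by
    rw [locallyIntegrableOn_iff (isOpen_coordDomain hΩ).isLocallyClosed]
    intro K hKs hK
    have hKt : K ⊆ e.target := hKs.trans inter_subset_left
    have h1 := (locallyIntegrableOn_comp_symm he hΩ
      hw.grad_sq_integrable).integrableOn_compact_subset hKs hK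
    have h2 := h1.mul_continuousOn ((contDiffOn_metricMatrix he i i).continuousOn.mono hKt) hK
    have h3 := ((hw.weakDifferential.locallyIntegrable_component e he
      i).integrableOn_compact_subset hKs hK).1
    refine Integrable.mono' h2 (h3.pow 2) (ae_of_all _ fun y => ?_)
    rw [Real.norm_of_nonneg (sq_nonneg _)]
    exact sq_apply_coordVec_le _ _
  integral_by_parts := fun i φ h1 h2 h3 =>
    hw.weakDifferential.integral_by_parts e he i φ h1 h2 h3

/-- The planar chain rule ∂(w²) = 2w∂w is tested against the components of the gradient density of
ψ, extended by zero. Summed over the components, one side becomes the pairing ⟨dw, dψ⟩ and the other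
the Laplacian of ψ, each with the volume density as factor. -/
theorem IsWeight.integral_mul_covecInner_of_subset_source (he : e ∈ atlas Plane M) (hΩ : IsOpen Ω)
    (hw : IsWeight Ω κ w dw) {ψ : M → ℝ} (hψ : IsTest Ω ψ) (hs : tsupport ψ ⊆ e.source) :
    Integrable (fun p => w p * covecInner (dw p) (mvfderiv (𝓡 2) ψ p)) (riemVolume M) ∧
    Integrable (fun p => w p ^ 2 * laplaceBeltrami ψ p) (riemVolume M) ∧
    2 * ∫ p, w p * covecInner (dw p) (mvfderiv (𝓡 2) ψ p) ∂riemVolume M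
      = - ∫ p, w p ^ 2 * laplaceBeltrami ψ p ∂riemVolume M := by
  have hS := hw.isSobolev he hΩ
  have hU := isOpen_coordDomain (e := e) hΩ
  obtain ⟨-, -, -, hK, hKU⟩ := push_spec he hψ hs
  set X : Fin 2 → Plane → ℝ := fun i => e.target.indicator (gradDensity e ψ i) with hX
  have hψ0 : ∀ y ∈ e.target, y ∉ e '' tsupport ψ → e.symm y ∉ tsupport ψ := fun y hy h h' =>
    h ⟨e.symm y, h', e.right_inv hy⟩
  have hXs := fun i => contDiff_indicator_of_compact e.open_target hK (hKU.trans inter_subset_left)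
    (contDiffOn_gradDensity he hψ.smooth i) (fun y hy hyK => by
      have h1 : ψ ∘ e.symm =ᶠ[𝓝 y] fun _ => 0 :=
        (notMem_tsupport_iff_eventuallyEq.1 (hψ0 y hy hyK)).comp_tendsto
          (e.continuousAt_symm hy)
      have h2 : ∀ j, partialD j (ψ ∘ e.symm) y = 0 := fun j =>
        partialD_eq_zero_of_eventuallyEq_const h1 j
      simp [gradDensity, h2])
  have int1 := fun i => hS.integrable_mul_deriv_mul hU (hXs i).1 (hXs i).2.1
    ((hXs i).2.2.trans hKU) i
  have int2 := fun i => hS.integral_sq_mul_partialD hU (hXs i).1 (hXs i).2.1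
    ((hXs i).2.2.trans hKU) i
  have int3 : ∀ i, Integrable fun y => w (e.symm y) ^ 2 * partialD i (X i) y := fun i => by
    have hsub := (tsupport_partialD_subset (X i) i).trans ((hXs i).2.2.trans hKU)
    rw [← integrableOn_iff_integrable_of_support_subset (s := tsupport (partialD i (X i)))
      ((Function.support_mul_subset_right _ _).trans (subset_tsupport _))]
    have hc := hasCompactSupport_partialD (hXs i).2.1 i
    exact (hS.sq.integrableOn_compact_subset hsub hc).mul_continuousOn
      (contDiff_partialD (hXs i).1 i).continuous.continuousOn hc
  have sup1 : Function.support (fun p => w p * covecInner (dw p) (mvfderiv (𝓡 2) ψ p))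
      ⊆ e.source := by
    intro p hp
    by_contra hpe
    refine hp ?_
    change w p * covecInner _ _ = 0
    rw [mvfderiv_eq_zero_of_notMem_tsupport fun h => hpe (hs h), covecInner_comm,
      covecInner_zero_left, mul_zero]
  have sup2 : Function.support (fun p => w p ^ 2 * laplaceBeltrami ψ p) ⊆ e.source := by
    intro p hp
    by_contra hpe
    refine hp ?_
    change w p ^ 2 * laplaceBeltrami ψ p = 0
    rw [laplaceBeltrami_eq_zero_of_notMem_tsupport fun h => hpe (hs h), mul_zero]
  have eq1 : EqOn (fun y => volDensity e y *
      (w (e.symm y) * covecInner (dw (e.symm y)) (mvfderiv (𝓡 2) ψ (e.symm y))))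
      (fun y => ∑ i, w (e.symm y) * dw (e.symm y) (coordVec e y i) * X i y) e.target := by
    intro y hy
    have := sum_mvfderiv_mul_gradDensity he hy (dw (e.symm y))
      (hψ.smooth.mdifferentiable (by simp) (e.symm y))
    simp only [hX, indicator_of_mem hy, mul_assoc, ← Finset.mul_sum, this]
    ring
  have eq2 : EqOn (fun y => volDensity e y * (w (e.symm y) ^ 2 * laplaceBeltrami ψ (e.symm y)))
      (fun y => ∑ i, w (e.symm y) ^ 2 * partialD i (X i) y) e.target := by
    intro y hy
    have := (volDensity_pos he hy).ne'
    simp only [laplaceBeltrami_eq he hψ.smooth (e.map_target hy), e.right_inv hy, divGrad, hX,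
      partialD_indicator e.open_target hy, ← Finset.mul_sum]
    field_simp
  have hm := e.open_target.measurableSet
  have J1 : Integrable fun y => ∑ i, w (e.symm y) * dw (e.symm y) (coordVec e y i) * X i y :=
    integrable_finsetSum _ fun i _ => int1 i
  have J2 : Integrable fun y => ∑ i, w (e.symm y) ^ 2 * partialD i (X i) y :=
    integrable_finsetSum _ fun i _ => int3 i
  refine ⟨?_, ?_, ?_⟩
  · rw [integrable_iff_integrableOn_chart he sup1, integrableOn_congr_fun eq1 hm]
    exact J1.integrableOn
  · rw [integrable_iff_integrableOn_chart he sup2, integrableOn_congr_fun eq2 hm]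
    exact J2.integrableOn
  · rw [integral_eq_integral_chart he sup1, integral_eq_integral_chart he sup2,
      setIntegral_congr_fun hm eq1, setIntegral_congr_fun hm eq2,
      setIntegral_eq_integral_of_forall_compl_eq_zero,
      setIntegral_eq_integral_of_forall_compl_eq_zero, integral_finsetSum _ fun i _ => int1 i,
      integral_finsetSum _ fun i _ => int3 i, Finset.mul_sum, ← Finset.sum_neg_distrib]
    · refine Finset.sum_congr rfl fun i _ => ?_
      rw [int2 i, neg_neg, integral_const_mul]
    · intro y hy
      refine Finset.sum_eq_zero fun i _ => ?_
      rw [image_eq_zero_of_notMem_tsupport fun h =>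
        hy (hKU ((hXs i).2.2 (tsupport_partialD_subset _ i h))).1, mul_zero]
    · intro y hy
      refine Finset.sum_eq_zero fun i _ => ?_
      simp [hX, indicator_of_notMem hy]

theorem mvfderiv_sum {ι : Type*} (s : Finset ι) {f : ι → M → ℝ}
    (hf : ∀ i ∈ s, IsTest Ω (f i)) (p : M) :
    mvfderiv (𝓡 2) (fun q => ∑ i ∈ s, f i q) p = ∑ i ∈ s, mvfderiv (𝓡 2) (f i) p := by
  classical
  induction s using Finset.induction_on with
  | empty => simpa using mvfderiv_const (I := 𝓡 2) (M := M) (0 : ℝ)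
  | insert a s ha ih =>
    have hs : ∀ i ∈ s, IsTest Ω (f i) := fun i hi => hf i (Finset.mem_insert_of_mem hi)
    simp only [Finset.sum_insert ha]
    rw [← ih hs]
    exact mvfderiv_add ((hf a (Finset.mem_insert_self _ _)).smooth.mdifferentiable (by simp) p)
      ((IsTest.sum s hs).smooth.mdifferentiable (by simp) p)

theorem covecInner_sum_right {ι : Type*} (s : Finset ι) {p : M}
    (α : TangentSpace (𝓡 2) p →L[ℝ] ℝ) (β : ι → TangentSpace (𝓡 2) p →L[ℝ] ℝ) :
    covecInner α (∑ i ∈ s, β i) = ∑ i ∈ s, covecInner α (β i) := by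
  simp [covecInner, inner_sum]

/-- The weak chain rule `∫ 2 w ⟨dw, dψ⟩ = - ∫ w² Δ ψ`. -/
theorem IsWeight.integral_mul_covecInner [SecondCountableTopology M] (hΩ : IsOpen Ω)
    (hw : IsWeight Ω κ w dw) {ψ : M → ℝ} (hψ : IsTest Ω ψ) :
    Integrable (fun p => w p * covecInner (dw p) (mvfderiv (𝓡 2) ψ p)) (riemVolume M) ∧
    Integrable (fun p => w p ^ 2 * laplaceBeltrami ψ p) (riemVolume M) ∧
    2 * ∫ p, w p * covecInner (dw p) (mvfderiv (𝓡 2) ψ p) ∂riemVolume M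
      = - ∫ p, w p ^ 2 * laplaceBeltrami ψ p ∂riemVolume M := by
  obtain ⟨s, Ψ, h1, h2, h3⟩ := hψ.exists_sum_chart
  have h := fun i => hw.integral_mul_covecInner_of_subset_source (chart_mem_atlas Plane i) hΩ
    (h1 i) (h2 i)
  have e0 : ψ = fun p => ∑ i ∈ s, Ψ i p := funext h3
  have e1 : ∀ p, w p * covecInner (dw p) (mvfderiv (𝓡 2) ψ p)
      = ∑ i ∈ s, w p * covecInner (dw p) (mvfderiv (𝓡 2) (Ψ i) p) := fun p => by
    rw [← Finset.mul_sum, ← covecInner_sum_right, ← mvfderiv_sum s fun i _ => h1 i, ← e0]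
  have e2 : ∀ p, w p ^ 2 * laplaceBeltrami ψ p
      = ∑ i ∈ s, w p ^ 2 * laplaceBeltrami (Ψ i) p := fun p => by
    rw [← Finset.mul_sum, ← laplaceBeltrami_sum s fun i _ => h1 i, ← e0]
  simp only [e1, e2]
  refine ⟨integrable_finsetSum _ fun i _ => (h i).1, integrable_finsetSum _ fun i _ => (h i).2.1, ?_⟩
  rw [integral_finsetSum _ fun i _ => (h i).1, integral_finsetSum _ fun i _ => (h i).2.1,
    Finset.mul_sum, ← Finset.sum_neg_distrib]
  exact Finset.sum_congr rfl fun i _ => (h i).2.2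

end Weight

/-! ### Approximation of fω by test functions, and the Rayleigh quotient. -/

theorem add_sq_le_of_pos {s : ℝ} (hs : 0 < s) (x y : ℝ) :
    (x + y) ^ 2 ≤ (1 + s) * x ^ 2 + (1 + s⁻¹) * y ^ 2 := by
  have h : s * s⁻¹ = 1 := mul_inv_cancel₀ hs.ne'
  have h1 : 0 ≤ s⁻¹ * (s * x - y) ^ 2 := by positivity
  have h2 : s⁻¹ * (s * x - y) ^ 2 = s * x ^ 2 - 2 * (x * y) + s⁻¹ * y ^ 2 := by
    linear_combination (s * x ^ 2 - 2 * x * y) * h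
  nlinarith

section Approx
variable {M : Type*} [TopologicalSpace M] [T2Space M] [ChartedSpace Plane M]
  [IsManifold (𝓡 2) ∞ M]
  [RiemannianBundle (fun p : M => TangentSpace (𝓡 2) p)]
  [IsContMDiffRiemannianBundle (𝓡 2) ∞ Plane (fun p : M => TangentSpace (𝓡 2) p)]
  [MeasurableSpace M] [BorelSpace M] {e : OpenPartialHomeomorph M Plane}
  {Ω : Set M} {κ w : M → ℝ} {dw : ∀ p : M, TangentSpace (𝓡 2) p →L[ℝ] ℝ}

theorem covecNormSq_add_le {s : ℝ} (hs : 0 < s) {p : M} (α β : TangentSpace (𝓡 2) p →L[ℝ] ℝ) :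
    covecNormSq (α + β) ≤ (1 + s) * covecNormSq α + (1 + s⁻¹) * covecNormSq β := by
  refine le_trans ?_ (add_sq_le_of_pos hs ‖α‖ ‖β‖)
  have h : ‖α + β‖ ≤ ‖α‖ + ‖β‖ := norm_add_le α β
  rw [covecNormSq]
  gcongr

/-- The function `u` with the covector field `θ` in the role of its differential is a limit in
`W^{1,2}` of test functions on `Ω`. -/
def IsTestLimit (Ω : Set M) (u : M → ℝ) (θ : ∀ p : M, TangentSpace (𝓡 2) p →L[ℝ] ℝ) : Prop :=
  ∀ δ > 0, ∃ v h : M → ℝ, IsTest Ω v ∧ Integrable h (riemVolume M) ∧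
    ∫ p, h p ∂riemVolume M ≤ δ ∧
    ∀ p, (v p - u p) ^ 2 + covecNormSq (mvfderiv (𝓡 2) v p - θ p) ≤ h p

theorem isTestLimit_zero (Ω : Set M) : IsTestLimit Ω (fun _ => 0) (fun _ => 0) := by
  refine fun δ hδ => ⟨fun _ => 0, fun _ => 0, isTest_zero Ω, integrable_zero _ _ _, by simpa using hδ.le,
    fun p => ?_⟩
  beta_reduce
  rw [mvfderiv_const, sub_self, sub_self, covecNormSq_eq_inner, covecInner_zero_left]
  simp

theorem IsTestLimit.add {u₁ u₂ : M → ℝ} {θ₁ θ₂ : ∀ p : M, TangentSpace (𝓡 2) p →L[ℝ] ℝ}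
    (h₁ : IsTestLimit Ω u₁ θ₁) (h₂ : IsTestLimit Ω u₂ θ₂) :
    IsTestLimit Ω (fun p => u₁ p + u₂ p) (fun p => θ₁ p + θ₂ p) := by
  intro δ hδ
  obtain ⟨v₁, k₁, a₁, b₁, c₁, d₁⟩ := h₁ (δ / 4) (by positivity)
  obtain ⟨v₂, k₂, a₂, b₂, c₂, d₂⟩ := h₂ (δ / 4) (by positivity)
  refine ⟨_, fun p => 2 * (k₁ p + k₂ p), a₁.add a₂, (b₁.add b₂).const_mul 2, ?_, fun p => ?_⟩
  · rw [integral_const_mul, integral_add b₁ b₂]; linarith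
  · rw [mvfderiv_fun_add (a₁.smooth.mdifferentiable (by simp) p)
      (a₂.smooth.mdifferentiable (by simp) p), add_sub_add_comm, add_sub_add_comm]
    have e1 := add_sq_le_of_pos one_pos (v₁ p - u₁ p) (v₂ p - u₂ p)
    have e2 := covecNormSq_add_le one_pos (mvfderiv (𝓡 2) v₁ p - θ₁ p) (mvfderiv (𝓡 2) v₂ p - θ₂ p)
    have := d₁ p
    have := d₂ p
    norm_num at e1 e2
    linarith

theorem IsTestLimit.sum {ι : Type*} (s : Finset ι) {u : ι → M → ℝ}
    {θ : ι → ∀ p : M, TangentSpace (𝓡 2) p →L[ℝ] ℝ} (h : ∀ i ∈ s, IsTestLimit Ω (u i) (θ i)) :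
    IsTestLimit Ω (fun p => ∑ i ∈ s, u i p) (fun p => ∑ i ∈ s, θ i p) := by
  classical
  induction s using Finset.induction_on with
  | empty => simpa using isTestLimit_zero Ω
  | insert a s ha ih =>
    simp only [Finset.sum_insert ha]
    exact (h a (Finset.mem_insert_self _ _)).add
      (ih fun i hi => h i (Finset.mem_insert_of_mem hi))

theorem dirichletEigenvalue_nonneg (Ω : Set M) : 0 ≤ dirichletEigenvalue Ω := by
  refine Real.sInf_nonneg ?_
  rintro r ⟨u, -, -, rfl⟩
  exact div_nonneg (integral_nonneg fun p => sq_nonneg _) (integral_nonneg fun p => sq_nonneg _)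

theorem IsTest.dirichletEigenvalue_mul_le {u : M → ℝ} (hu : IsTest Ω u) :
    dirichletEigenvalue Ω * ∫ p, u p ^ 2 ∂riemVolume M ≤ ∫ p, gradSq u p ∂riemVolume M := by
  have h0 : ∀ p ∉ Ω, p ∉ tsupport u := fun p hp h => hp (hu.subset h)
  have e1 : ∫ p in Ω, u p ^ 2 ∂riemVolume M = ∫ p, u p ^ 2 ∂riemVolume M :=
    setIntegral_eq_integral_of_forall_compl_eq_zero fun p hp => by
      simp [image_eq_zero_of_notMem_tsupport (h0 p hp)]
  have e2 : ∫ p in Ω, gradSq u p ∂riemVolume M = ∫ p, gradSq u p ∂riemVolume M :=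
    setIntegral_eq_integral_of_forall_compl_eq_zero fun p hp =>
      gradSq_eq_zero_of_notMem_tsupport (h0 p hp)
  have hN : 0 ≤ ∫ p, gradSq u p ∂riemVolume M := integral_nonneg fun p => sq_nonneg _
  have hD : 0 ≤ ∫ p, u p ^ 2 ∂riemVolume M := integral_nonneg fun p => sq_nonneg _
  -- If the L² norm vanishes, the left side is 0; otherwise `u` is nonzero and its Rayleigh quotient
  -- competes in the infimum.
  rcases hD.eq_or_lt with hD0 | hD0
  · rw [← hD0, mul_zero]; exact hN
  · rw [← le_div_iff₀ hD0]
    refine csInf_le ⟨0, ?_⟩ ⟨u, hu, ?_, by rw [e1, e2]⟩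
    · rintro r ⟨u, -, -, rfl⟩
      exact div_nonneg (integral_nonneg fun p => sq_nonneg _) (integral_nonneg fun p => sq_nonneg _)
    · rintro rfl
      simp at hD0

theorem IsTest.integrable_gradSq {u : M → ℝ} (hu : IsTest Ω u) :
    Integrable (gradSq u) (riemVolume M) :=
  (continuous_gradSq hu.smooth).integrable_of_hasCompactSupport
    (hu.compact.mono' fun p hp => by
      by_contra h; exact hp (gradSq_eq_zero_of_notMem_tsupport h))

/-- The eigenvalue inequality passes to the limit. Both |u|² against |v|² and |dv|² against |θ|² are
compared with constants 1 + s and 1 + s⁻¹; an approximation error s² then contributes (1 + s⁻¹)s² =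
s² + s, which disappears as s → 0. -/
theorem IsTestLimit.dirichletEigenvalue_mul_le {u : M → ℝ}
    {θ : ∀ p : M, TangentSpace (𝓡 2) p →L[ℝ] ℝ} (h : IsTestLimit Ω u θ)
    (hu : Integrable (fun p => u p ^ 2) (riemVolume M))
    (hθ : Integrable (fun p => covecNormSq (θ p)) (riemVolume M)) :
    dirichletEigenvalue Ω * ∫ p, u p ^ 2 ∂riemVolume M
      ≤ ∫ p, covecNormSq (θ p) ∂riemVolume M := by
  set l := dirichletEigenvalue Ω with hl
  have hl0 : 0 ≤ l := dirichletEigenvalue_nonneg Ω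
  set T := ∫ p, covecNormSq (θ p) ∂riemVolume M with hT
  have main : ∀ s > 0, l * ∫ p, u p ^ 2 ∂riemVolume M
      ≤ (1 + s) * ((1 + s) * T + (s ^ 2 + s)) + l * (s ^ 2 + s) := by
    intro s hs
    obtain ⟨v, k, hv, ik, hk, hvk⟩ := h (s ^ 2) (by positivity)
    have iv : Integrable (fun p => v p ^ 2) (riemVolume M) :=
      (hv.smooth.continuous.pow 2).integrable_of_hasCompactSupport
        (hv.compact.mono fun p hp h => hp (by simp [h]))
    have hs2 : (1 + s⁻¹) * s ^ 2 = s ^ 2 + s := by field_simp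
    have b1 : ∫ p, u p ^ 2 ∂riemVolume M ≤ (1 + s) * ∫ p, v p ^ 2 ∂riemVolume M + (s ^ 2 + s) := by
      calc _ ≤ ∫ p, ((1 + s) * v p ^ 2 + (1 + s⁻¹) * k p) ∂riemVolume M := by
            refine integral_mono hu ((iv.const_mul _).add (ik.const_mul _)) fun p => ?_
            have e1 := add_sq_le_of_pos hs (v p) (u p - v p)
            have e2 := hvk p
            have e3 := covecNormSq_nonneg (mvfderiv (𝓡 2) v p - θ p)
            have e4 : (u p - v p) ^ 2 ≤ k p := by nlinarith
            have e5 : (1 + s⁻¹) * (u p - v p) ^ 2 ≤ (1 + s⁻¹) * k p := by gcongr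
            rw [add_sub_cancel] at e1
            simp only; linarith
        _ = (1 + s) * ∫ p, v p ^ 2 ∂riemVolume M + (1 + s⁻¹) * ∫ p, k p ∂riemVolume M := by
            rw [integral_add (iv.const_mul _) (ik.const_mul _), integral_const_mul,
              integral_const_mul]
        _ ≤ _ := by rw [← hs2]; gcongr
    have b2 : ∫ p, gradSq v p ∂riemVolume M ≤ (1 + s) * T + (s ^ 2 + s) := by
      calc _ ≤ ∫ p, ((1 + s) * covecNormSq (θ p) + (1 + s⁻¹) * k p) ∂riemVolume M := by
            refine integral_mono hv.integrable_gradSq ((hθ.const_mul _).add (ik.const_mul _))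
              fun p => ?_
            have e1 := covecNormSq_add_le hs (θ p) (mvfderiv (𝓡 2) v p - θ p)
            have e2 := hvk p
            have e4 : covecNormSq (mvfderiv (𝓡 2) v p - θ p) ≤ k p := by nlinarith
            have e5 : (1 + s⁻¹) * covecNormSq (mvfderiv (𝓡 2) v p - θ p) ≤ (1 + s⁻¹) * k p := by
              gcongr
            rw [add_sub_cancel] at e1
            simp only [gradSq]; linarith
        _ = (1 + s) * T + (1 + s⁻¹) * ∫ p, k p ∂riemVolume M := by
            rw [integral_add (hθ.const_mul _) (ik.const_mul _), integral_const_mul,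
              integral_const_mul]
        _ ≤ _ := by rw [← hs2]; gcongr
    have b3 := hv.dirichletEigenvalue_mul_le
    calc _ ≤ l * ((1 + s) * ∫ p, v p ^ 2 ∂riemVolume M + (s ^ 2 + s)) := by gcongr
      _ = (1 + s) * (l * ∫ p, v p ^ 2 ∂riemVolume M) + l * (s ^ 2 + s) := by ring
      _ ≤ _ := by
        have := b3.trans b2
        gcongr
  have hlim : Tendsto (fun s : ℝ => (1 + s) * ((1 + s) * T + (s ^ 2 + s)) + l * (s ^ 2 + s))
      (𝓝[>] 0) (𝓝 T) := by
    have : Continuous fun s : ℝ => (1 + s) * ((1 + s) * T + (s ^ 2 + s)) + l * (s ^ 2 + s) := by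
      fun_prop
    have h1 := this.tendsto 0
    simp at h1
    exact h1.mono_left nhdsWithin_le_nhds
  refine ge_of_tendsto hlim ?_
  filter_upwards [self_mem_nhdsWithin] with s hs using main s hs

theorem covecNormSq_le_mul_sum_sq (he : e ∈ atlas Plane M) {y : Plane} (hy : y ∈ e.target)
    (α : TangentSpace (𝓡 2) (e.symm y) →L[ℝ] ℝ) :
    covecNormSq α ≤ (∑ i, ∑ j, |(metricMatrix e y)⁻¹ i j|) * ∑ i, α (coordVec e y i) ^ 2 := by
  rw [covecNormSq_eq_sum he hy, Finset.sum_mul]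
  refine Finset.sum_le_sum fun i _ => ?_
  rw [Finset.sum_mul]
  refine Finset.sum_le_sum fun j _ => ?_
  refine (le_abs_self _).trans ?_
  rw [abs_mul]
  gcongr
  have h : ∀ i, α (coordVec e y i) ^ 2 ≤ ∑ i, α (coordVec e y i) ^ 2 := fun i =>
    Finset.single_le_sum (f := fun i => α (coordVec e y i) ^ 2) (fun i _ => sq_nonneg _)
      (Finset.mem_univ i)
  rw [abs_le]
  constructor <;>
    nlinarith [h i, h j, sq_nonneg (α (coordVec e y i) + α (coordVec e y j)),
      sq_nonneg (α (coordVec e y i) - α (coordVec e y j))]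

/-- Planar approximations of the product are pulled back to `M`. Their supports stay in a compact
set `K` independent of `δ`, on which the volume density and the inverse metric are bounded, so
planar W^{1,2} errors control Riemannian ones uniformly. -/
theorem IsWeight.isTestLimit_of_subset_source (he : e ∈ atlas Plane M) (hΩ : IsOpen Ω)
    (hw : IsWeight Ω κ w dw) {η : M → ℝ} (hη : IsTest Ω η) (hs : tsupport η ⊆ e.source) :
    IsTestLimit Ω (fun p => η p * w p) (fun p => η p • dw p + w p • mvfderiv (𝓡 2) η p) := by
  have hS := hw.isSobolev he hΩ
  have hU := isOpen_coordDomain (e := e) hΩ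
  obtain ⟨q1, q2, q3, q4, q5⟩ := push_spec he hη hs
  set χ := e.target.indicator (η ∘ e.symm) with hχ
  obtain ⟨K, hKU, hK, hχK, happ⟩ := hS.exists_approx hU q1 q2 (q3.trans q5)
  have hKt : K ⊆ e.target := hKU.trans inter_subset_left
  obtain ⟨C, hC⟩ := hK.exists_bound_of_continuousOn
    (f := fun y => ∑ i, ∑ j, |(metricMatrix e y)⁻¹ i j|)
    (continuousOn_finsetSum _ fun i _ => continuousOn_finsetSum _ fun j _ =>
      ((contDiffOn_inv_metricMatrix he i j).continuousOn.mono hKt).abs)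
  obtain ⟨B, hB⟩ := hK.exists_bound_of_continuousOn
    ((contDiffOn_volDensity he).continuousOn.mono hKt)
  intro δ hδ
  -- `A` compares the Riemannian norms with the Euclidean ones and 1 + |B| bounds the volume density
  -- on `K`. The factor 3 counts the planar errors, one for the function and two for its
  -- derivatives, each at most `δ / R`.
  set A := 1 + |C| with hA
  set R := A * (1 + |B|) * 3 with hR
  have hApos : 0 < A := by positivity
  have hRpos : 0 < R := by positivity
  obtain ⟨v, hv, hvK, ⟨i1, le1⟩, h2⟩ := happ (δ / R) (by positivity)
  set D : Plane → ℝ := fun y => (v y - χ y * w (e.symm y)) ^ 2 + ∑ i,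
    (partialD i v y - (χ y * dw (e.symm y) (coordVec e y i) + partialD i χ y * w (e.symm y))) ^ 2
    with hD
  have hD0 : ∀ y, 0 ≤ D y := fun y => by
    have : 0 ≤ ∑ i, (partialD i v y - (χ y * dw (e.symm y) (coordVec e y i)
      + partialD i χ y * w (e.symm y))) ^ 2 := Finset.sum_nonneg fun i _ => sq_nonneg _
    have := sq_nonneg (v y - χ y * w (e.symm y))
    simp only [hD]; linarith
  have hDK : ∀ y ∉ K, D y = 0 := fun y hy => by
    have a1 : v y = 0 := image_eq_zero_of_notMem_tsupport fun h => hy (hvK h)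
    have a2 : χ y = 0 := image_eq_zero_of_notMem_tsupport fun h => hy (hχK h)
    have a3 : ∀ i, partialD i v y = 0 := fun i =>
      image_eq_zero_of_notMem_tsupport fun h => hy (hvK (tsupport_partialD_subset _ i h))
    have a4 : ∀ i, partialD i χ y = 0 := fun i =>
      image_eq_zero_of_notMem_tsupport fun h => hy (hχK (tsupport_partialD_subset _ i h))
    simp [hD, a1, a2, a3, a4]
  have iD : Integrable D := i1.add (integrable_finsetSum _ fun i _ => (h2 i).1)
  have leD : ∫ y, D y ≤ 3 * (δ / R) := by
    simp only [hD]
    rw [integral_add i1 (integrable_finsetSum _ fun i _ => (h2 i).1),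
      integral_finsetSum _ fun i _ => (h2 i).1, Fin.sum_univ_two]
    have := (h2 0).2
    have := (h2 1).2
    linarith
  set k : M → ℝ := e.source.indicator fun p => A * D (e p) with hk
  have hksupp : Function.support k ⊆ e.source := support_indicator_subset
  have hkc : ∀ y ∈ e.target, k (e.symm y) = A * D y := fun y hy => by
    simp [hk, e.map_target hy, e.right_inv hy]
  have bound : ∀ y ∈ e.target, ‖volDensity e y * k (e.symm y)‖ ≤ (A * (1 + |B|)) * D y := by
    intro y hy
    rw [hkc y hy, norm_mul, Real.norm_of_nonneg (mul_nonneg hApos.le (hD0 y))]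
    by_cases hyK : y ∈ K
    · have h1 : ‖volDensity e y‖ ≤ 1 + |B| := (hB y hyK).trans (by linarith [le_abs_self B])
      calc _ ≤ (1 + |B|) * (A * D y) :=
            mul_le_mul_of_nonneg_right h1 (mul_nonneg hApos.le (hD0 y))
        _ = _ := by ring
    · simp [hDK y hyK]
  have hm := e.open_target.measurableSet
  have ik : IntegrableOn (fun y => volDensity e y * k (e.symm y)) e.target := by
    refine Integrable.mono' (iD.const_mul (A * (1 + |B|))).integrableOn ?_
      ((ae_restrict_iff' hm).2 (ae_of_all _ bound))
    refine AEStronglyMeasurable.mul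
      ((contDiffOn_volDensity he).continuousOn.aestronglyMeasurable hm) ?_
    refine AEStronglyMeasurable.congr (f := fun y => A * D y)
      (iD.const_mul A).aestronglyMeasurable.restrict ?_
    exact (ae_restrict_iff' hm).2 (ae_of_all _ fun y hy => (hkc y hy).symm)
  have hT := isTest_pull he hv (hK.of_isClosed_subset (isClosed_tsupport _) hvK) (hvK.trans hKU)
  refine ⟨pull e v, k, ⟨hT.smooth, hT.compact, hT.subset.trans inter_subset_left⟩,
    (integrable_iff_integrableOn_chart he hksupp).2 ik, ?_, fun p => ?_⟩
  · rw [integral_eq_integral_chart he hksupp]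
    calc _ ≤ ∫ y in e.target, (A * (1 + |B|)) * D y :=
          setIntegral_mono_on ik (iD.const_mul _).integrableOn hm
            fun y hy => (le_abs_self _).trans (bound y hy)
      _ ≤ ∫ y, (A * (1 + |B|)) * D y := by
          refine setIntegral_le_integral (iD.const_mul _) (ae_of_all _ fun y => ?_)
          have := hD0 y
          simp only [Pi.zero_apply]; positivity
      _ = (A * (1 + |B|)) * ∫ y, D y := integral_const_mul _ _
      _ ≤ (A * (1 + |B|)) * (3 * (δ / R)) := by gcongr
      _ = δ := by rw [hR]; field_simp
  · beta_reduce
    by_cases hp : p ∈ e.source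
    · obtain ⟨y, hy, rfl⟩ : ∃ y ∈ e.target, e.symm y = p := ⟨e p, e.map_source hp, e.left_inv hp⟩
      rw [hkc y hy, pull_symm hy]
      have hηχ : η (e.symm y) = χ y := by rw [hχ, indicator_of_mem hy]; rfl
      have hcoord : ∀ i, (mvfderiv (𝓡 2) (pull e v) (e.symm y) - (η (e.symm y) • dw (e.symm y)
          + w (e.symm y) • mvfderiv (𝓡 2) η (e.symm y))) (coordVec e y i)
          = partialD i v y - (χ y * dw (e.symm y) (coordVec e y i)
            + partialD i χ y * w (e.symm y)) := by
        intro i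
        have e1 := mvfderiv_coordVec he hy (hT.smooth.mdifferentiable (by simp) (e.symm y)) i
        have e2 := mvfderiv_coordVec he hy (hη.smooth.mdifferentiable (by simp) (e.symm y)) i
        have e3 : partialD i (pull e v ∘ e.symm) y = partialD i v y := partialD_congr (by
          filter_upwards [e.open_target.mem_nhds hy] with z hz using pull_symm hz v) i
        have e4 : partialD i χ y = partialD i (η ∘ e.symm) y :=
          partialD_indicator e.open_target hy _ i
        rw [sub_apply, add_apply, smul_apply, smul_apply, e1, e2, e3, e4, hηχ, smul_eq_mul,
          smul_eq_mul, mul_comm (w (e.symm y))]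
      have e5 := covecNormSq_le_mul_sum_sq he hy (mvfderiv (𝓡 2) (pull e v) (e.symm y) -
        (η (e.symm y) • dw (e.symm y) + w (e.symm y) • mvfderiv (𝓡 2) η (e.symm y)))
      simp only [hcoord] at e5
      set S := ∑ i, (partialD i v y - (χ y * dw (e.symm y) (coordVec e y i)
            + partialD i χ y * w (e.symm y))) ^ 2 with hSdef
      have hS0 : 0 ≤ S := Finset.sum_nonneg fun i _ => sq_nonneg _
      have hDy : D y = (v y - χ y * w (e.symm y)) ^ 2 + S := rfl
      by_cases hyK : y ∈ K
      · have h6 := (le_abs_self _).trans (hC y hyK)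
        have h7 : (∑ i, ∑ j, |(metricMatrix e y)⁻¹ i j|) * S ≤ |C| * S :=
          mul_le_mul_of_nonneg_right (h6.trans (le_abs_self C)) hS0
        rw [hηχ] at e5 ⊢
        rw [hDy]
        have h8 : 0 ≤ |C| * (v y - χ y * w (e.symm y)) ^ 2 := by positivity
        have h9 : A * ((v y - χ y * w (e.symm y)) ^ 2 + S) = (v y - χ y * w (e.symm y)) ^ 2 + S
          + |C| * (v y - χ y * w (e.symm y)) ^ 2 + |C| * S := by rw [hA]; ring
        rw [h9]
        linarith
      · have h0 := hDK y hyK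
        rw [hDy] at h0
        have hsq := sq_nonneg (v y - χ y * w (e.symm y))
        have hS1 : S = 0 := by linarith
        rw [hS1, mul_zero] at e5
        rw [hηχ] at e5 ⊢
        rw [hDy, h0, mul_zero]
        linarith
    · have hη0 : p ∉ tsupport η := fun h => hp (hs h)
      have hv0 : p ∉ tsupport (pull e v) := fun h => hp (hT.subset h).2
      rw [image_eq_zero_of_notMem_tsupport hη0, image_eq_zero_of_notMem_tsupport hv0,
        mvfderiv_eq_zero_of_notMem_tsupport hη0, mvfderiv_eq_zero_of_notMem_tsupport hv0, hk,
        indicator_of_notMem hp]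
      simp [covecNormSq_eq_inner, covecInner_zero_left]

/-- The product of a weight with a test function is a `W^{1,2}` limit of test functions. -/
theorem IsWeight.isTestLimit [SecondCountableTopology M] (hΩ : IsOpen Ω)
    (hw : IsWeight Ω κ w dw) {η : M → ℝ} (hη : IsTest Ω η) :
    IsTestLimit Ω (fun p => η p * w p) (fun p => η p • dw p + w p • mvfderiv (𝓡 2) η p) := by
  obtain ⟨s, Ψ, h1, h2, h3⟩ := hη.exists_sum_chart
  have h := IsTestLimit.sum s fun i _ =>
    hw.isTestLimit_of_subset_source (chart_mem_atlas Plane i) hΩ (h1 i) (h2 i)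
  have e0 : η = fun p => ∑ i ∈ s, Ψ i p := funext h3
  convert! h using 2 with p p
  · rw [← Finset.sum_mul, ← h3]
  · rw [Finset.sum_add_distrib, ← Finset.sum_smul, ← Finset.smul_sum, ← h3,
      ← mvfderiv_sum s fun i _ => h1 i, ← e0]

end Approx

/-! ### The energy identity and the eigenvalue estimate. -/

/-- For b > 0 this is 2|v²l||x| ≤ v⁴l²/b + bx², which explains the 5 = 4 + 1; the quotient on the
right has coefficient 2 and so leaves room. For b = 0 extended division does what the convention at
critical points of ω asks: 0/0 = 0, in which case the left side vanishes too, and a positive number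
over 0 is ∞. -/
theorem ofReal_add_two_mul_abs_le {b l x : ℝ} (hb : 0 ≤ b) (v : ℝ) :
    ENNReal.ofReal (4 * (b * x ^ 2) + 2 * |v ^ 2 * (x * l)|)
      ≤ ENNReal.ofReal (2 * v ^ 4 * l ^ 2) / ENNReal.ofReal b + ENNReal.ofReal (5 * b * x ^ 2) := by
  rcases hb.eq_or_lt with rfl | hb
  · by_cases h : v ^ 2 * l = 0
    · have : v ^ 2 * (x * l) = 0 := by rw [mul_left_comm, h, mul_zero]
      simp [this]
    · have h1 : 0 < 2 * v ^ 4 * l ^ 2 := by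
        have : 0 < (v ^ 2 * l) ^ 2 := by positivity
        nlinarith
      rw [ENNReal.ofReal_zero, ENNReal.div_zero (by simpa using h1)]
      simp
  · rw [← ENNReal.ofReal_div_of_pos hb, ← ENNReal.ofReal_add (by positivity) (by positivity)]
    refine ENNReal.ofReal_le_ofReal ?_
    have e1 : 0 ≤ (|v ^ 2 * l| - b * |x|) ^ 2 / b := by positivity
    have e2 : (|v ^ 2 * l| - b * |x|) ^ 2 / b
        = v ^ 4 * l ^ 2 / b - 2 * |v ^ 2 * (x * l)| + b * x ^ 2 := by
      rw [show v ^ 2 * (x * l) = v ^ 2 * l * x by ring, abs_mul _ x, ← sq_abs x,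
        show v ^ 4 * l ^ 2 = |v ^ 2 * l| ^ 2 by rw [sq_abs]; ring]
      field_simp
      ring
    have e3 : 0 ≤ v ^ 4 * l ^ 2 / b := by positivity
    have e4 : 2 * v ^ 4 * l ^ 2 / b = 2 * (v ^ 4 * l ^ 2 / b) := by ring
    rw [e4]
    linarith

section Main
variable {M : Type*} [TopologicalSpace M] [T2Space M] [SecondCountableTopology M]
  [ChartedSpace Plane M] [IsManifold (𝓡 2) ∞ M]
  [RiemannianBundle (fun p : M => TangentSpace (𝓡 2) p)]
  [IsContMDiffRiemannianBundle (𝓡 2) ∞ Plane (fun p : M => TangentSpace (𝓡 2) p)]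
  [MeasurableSpace M] [BorelSpace M]
  {Ω : Set M} {κ w f : M → ℝ} {dw : ∀ p : M, TangentSpace (𝓡 2) p →L[ℝ] ℝ}

theorem IsTest.integrable_mul (hf : IsTest Ω f) {h g : M → ℝ}
    (hh : LocallyIntegrableOn h Ω (riemVolume M)) (hg : Continuous g)
    (hgf : ∀ p ∉ tsupport f, g p = 0) : Integrable (fun p => h p * g p) (riemVolume M) := by
  rw [← integrableOn_iff_integrable_of_support_subset (s := tsupport f)]
  · exact (hh.integrableOn_compact_subset hf.subset hf.compact).mul_continuousOn hg.continuousOn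
      hf.compact
  · intro p hp
    by_contra h
    exact hp (by simp [hgf p h])

/-- The energy identity `∫ w² |∇f|² = ∫ (2 |∇w|² - κ w²) f² - ∫ w² f Δf`. -/
theorem IsWeight.integral_sq_mul_gradSq (hw : IsWeight Ω κ w dw) (hf : IsTest Ω f) :
    ∫ p, w p ^ 2 * gradSq f p ∂riemVolume M
      = 2 * ∫ p, covecNormSq (dw p) * f p ^ 2 ∂riemVolume M
        - ∫ p, κ p * w p ^ 2 * f p ^ 2 ∂riemVolume M
        - ∫ p, w p ^ 2 * (f p * laplaceBeltrami f p) ∂riemVolume M := by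
  have z : ∀ p ∉ tsupport f, f p = 0 := fun p => image_eq_zero_of_notMem_tsupport
  have hfc := hf.smooth.continuous
  have iA := hf.integrable_mul hw.sq_integrable (continuous_gradSq hf.smooth)
    fun p hp => gradSq_eq_zero_of_notMem_tsupport hp
  have iB := hf.integrable_mul (g := fun p => f p ^ 2) hw.grad_sq_integrable (hfc.pow 2)
    fun p hp => by simp [z p hp]
  have iK := hf.integrable_mul (g := fun p => f p ^ 2) hw.curv_integrable (hfc.pow 2)
    fun p hp => by simp [z p hp]
  have iC := hf.integrable_mul (g := fun p => f p * laplaceBeltrami f p) hw.sq_integrable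
    (hfc.mul (continuous_laplaceBeltrami hf.smooth)) fun p hp => by simp [z p hp]
  -- The test function is f²; its Laplacian 2|∇f|² + 2fΔf brings in the energy to be computed.
  have h := hw.equation _ (hf.mul_right hf.smooth)
  rw [setIntegral_eq_integral_of_forall_compl_eq_zero fun p hp => by
    have hp' : p ∉ tsupport f := fun h => hp (hf.subset h)
    rw [laplaceBeltrami_sq hf.smooth, z p hp', gradSq_eq_zero_of_notMem_tsupport hp']
    ring] at h
  have e : ∀ p, (4 * covecNormSq (dw p) - 2 * κ p * w p ^ 2) * (f p * f p)
      - w p ^ 2 * laplaceBeltrami (fun q => f q * f q) p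
      = (4 * (covecNormSq (dw p) * f p ^ 2) - 2 * (κ p * w p ^ 2 * f p ^ 2))
        - (2 * (w p ^ 2 * gradSq f p) + 2 * (w p ^ 2 * (f p * laplaceBeltrami f p))) := fun p => by
    rw [laplaceBeltrami_sq hf.smooth]; ring
  simp only [e] at h
  have i1 : Integrable (fun p => 4 * (covecNormSq (dw p) * f p ^ 2)
      - 2 * (κ p * w p ^ 2 * f p ^ 2)) (riemVolume M) := (iB.const_mul 4).sub (iK.const_mul 2)
  have i2 : Integrable (fun p => 2 * (w p ^ 2 * gradSq f p)
      + 2 * (w p ^ 2 * (f p * laplaceBeltrami f p))) (riemVolume M) :=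
    (iA.const_mul 2).add (iC.const_mul 2)
  rw [integral_sub i1 i2, integral_sub (iB.const_mul 4) (iK.const_mul 2),
    integral_add (iA.const_mul 2) (iC.const_mul 2)] at h
  simp only [integral_const_mul] at h
  linarith

/-- The Dirichlet eigenvalue estimate applied to `f w`. -/
theorem IsWeight.dirichletEigenvalue_mul_le (hΩ : IsOpen Ω) (hw : IsWeight Ω κ w dw)
    (hf : IsTest Ω f) :
    dirichletEigenvalue Ω * ∫ p, w p ^ 2 * f p ^ 2 ∂riemVolume M
      ≤ ∫ p, covecNormSq (dw p) * f p ^ 2 ∂riemVolume M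
        - ∫ p, w p ^ 2 * (f p * laplaceBeltrami f p) ∂riemVolume M := by
  have z : ∀ p ∉ tsupport f, f p = 0 := fun p => image_eq_zero_of_notMem_tsupport
  have hfc := hf.smooth.continuous
  have iW := hf.integrable_mul (g := fun p => f p ^ 2) hw.sq_integrable (hfc.pow 2) fun p hp => by simp [z p hp]
  have iA := hf.integrable_mul hw.sq_integrable (continuous_gradSq hf.smooth)
    fun p hp => gradSq_eq_zero_of_notMem_tsupport hp
  have iB := hf.integrable_mul (g := fun p => f p ^ 2) hw.grad_sq_integrable (hfc.pow 2)
    fun p hp => by simp [z p hp]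
  have iC := hf.integrable_mul (g := fun p => f p * laplaceBeltrami f p) hw.sq_integrable
    (hfc.mul (continuous_laplaceBeltrami hf.smooth)) fun p hp => by simp [z p hp]
  -- The cross term 2fw⟨dw, df⟩ of |d(fw)|² is w⟨dw, d(f²)⟩. The weak chain rule with ψ = f² gives
  -- its integral as −∫w²|∇f|² − ∫w²fΔf, so the energy of f cancels from that of fw.
  obtain ⟨iI, -, hI⟩ := hw.integral_mul_covecInner hΩ (hf.mul_right hf.smooth)
  have e1 : ∀ p, w p * covecInner (dw p) (mvfderiv (𝓡 2) (fun q => f q * f q) p)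
      = 2 * (f p * w p) * covecInner (dw p) (mvfderiv (𝓡 2) f p) := fun p => by
    rw [mvfderiv_mul_apply hf.smooth hf.smooth, covecInner_add_right, covecInner_smul_right]
    ring
  have e2 : ∀ p, w p ^ 2 * laplaceBeltrami (fun q => f q * f q) p
      = 2 * (w p ^ 2 * gradSq f p) + 2 * (w p ^ 2 * (f p * laplaceBeltrami f p)) := fun p => by
    rw [laplaceBeltrami_sq hf.smooth]; ring
  simp only [e1] at iI
  simp only [e1, e2] at hI
  rw [integral_add (iA.const_mul 2) (iC.const_mul 2), integral_const_mul, integral_const_mul] at hI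
  have e3 : ∀ p, covecNormSq (f p • dw p + w p • mvfderiv (𝓡 2) f p)
      = covecNormSq (dw p) * f p ^ 2
        + 2 * (f p * w p) * covecInner (dw p) (mvfderiv (𝓡 2) f p) + w p ^ 2 * gradSq f p := by
    intro p
    rw [covecNormSq_add, covecNormSq_smul, covecNormSq_smul, covecInner_smul_left,
      covecInner_smul_right, gradSq]
    ring
  have i1 : Integrable (fun p => covecNormSq (dw p) * f p ^ 2
      + 2 * (f p * w p) * covecInner (dw p) (mvfderiv (𝓡 2) f p)) (riemVolume M) := iB.add iI
  have i2 : Integrable (fun p => covecNormSq (f p • dw p + w p • mvfderiv (𝓡 2) f p))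
      (riemVolume M) := by
    simp only [e3]; exact i1.add iA
  have e4 : ∀ p, (f p * w p) ^ 2 = w p ^ 2 * f p ^ 2 := fun p => by ring
  have h := (hw.isTestLimit hΩ hf).dirichletEigenvalue_mul_le (by simpa only [e4] using iW) i2
  simp only [e3, e4] at h
  rw [integral_add i1 iA, integral_add iB iI] at h
  linarith

end Main

end Surface

/-! ### The weighted inequality. -/

open Surface

theorem mainTheorem2 {M : Type*} [TopologicalSpace M] [T2Space M] [SecondCountableTopology M]
    [ChartedSpace Surface.Plane M] [IsManifold (𝓡 2) ∞ M]
    [RiemannianBundle (fun p : M => TangentSpace (𝓡 2) p)]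
    [IsContMDiffRiemannianBundle (𝓡 2) ∞ Surface.Plane (fun p : M => TangentSpace (𝓡 2) p)]
    [MeasurableSpace M] [BorelSpace M]
    (Ω : Set M) (hΩ : IsOpen Ω)
    (κ w : M → ℝ) (dw : ∀ p : M, TangentSpace (𝓡 2) p →L[ℝ] ℝ)
    (hw : Surface.IsWeight Ω κ w dw)
    (τ : ℝ) (hτ₀ : 0 ≤ τ) (hτ₂ : τ ≤ 2)
    (hκ : ∀ᵐ p ∂(Surface.riemVolume M).restrict Ω,
      -(Surface.dirichletEigenvalue Ω / 8) * (2 - τ) ≤ κ p ∧ κ p ≤ Surface.dirichletEigenvalue Ω)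
    (f : M → ℝ) (hf : Surface.IsTest Ω f) :
    ENNReal.ofReal τ *
        ∫⁻ p in Ω, ENNReal.ofReal (w p ^ 2 * Surface.gradSq f p) ∂Surface.riemVolume M
      ≤ ∫⁻ p in Ω,
          (ENNReal.ofReal (2 * w p ^ 4 * Surface.laplaceBeltrami f p ^ 2)
              / ENNReal.ofReal (Surface.covecNormSq (dw p))
            + ENNReal.ofReal (5 * Surface.covecNormSq (dw p) * f p ^ 2))
          ∂Surface.riemVolume M := by
  have z : ∀ p ∉ tsupport f, f p = 0 := fun p => image_eq_zero_of_notMem_tsupport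
  have zΩ : ∀ p ∉ Ω, p ∉ tsupport f := fun p hp h => hp (hf.subset h)
  have hfc := hf.smooth.continuous
  have iW := hf.integrable_mul (g := fun p => f p ^ 2) hw.sq_integrable (hfc.pow 2) fun p hp => by simp [z p hp]
  have iA := hf.integrable_mul hw.sq_integrable (continuous_gradSq hf.smooth)
    fun p hp => gradSq_eq_zero_of_notMem_tsupport hp
  have iB := hf.integrable_mul (g := fun p => f p ^ 2) hw.grad_sq_integrable (hfc.pow 2)
    fun p hp => by simp [z p hp]
  have iK := hf.integrable_mul (g := fun p => f p ^ 2) hw.curv_integrable (hfc.pow 2)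
    fun p hp => by simp [z p hp]
  have iC := hf.integrable_mul (g := fun p => f p * laplaceBeltrami f p) hw.sq_integrable
    (hfc.mul (continuous_laplaceBeltrami hf.smooth)) fun p hp => by simp [z p hp]
  have h1 := hw.integral_sq_mul_gradSq hf
  have h2 := hw.dirichletEigenvalue_mul_le hΩ hf
  set l := dirichletEigenvalue Ω
  set A := ∫ p, w p ^ 2 * gradSq f p ∂riemVolume M with hA
  set B := ∫ p, covecNormSq (dw p) * f p ^ 2 ∂riemVolume M with hB
  set K := ∫ p, κ p * w p ^ 2 * f p ^ 2 ∂riemVolume M with hK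
  set C := ∫ p, w p ^ 2 * (f p * laplaceBeltrami f p) ∂riemVolume M with hC
  set W := ∫ p, w p ^ 2 * f p ^ 2 ∂riemVolume M with hW
  set C' := ∫ p, |w p ^ 2 * (f p * laplaceBeltrami f p)| ∂riemVolume M with hC'
  have h3 : -(l / 8) * (2 - τ) * W ≤ K := by
    rw [hW, hK, ← setIntegral_eq_integral_of_forall_compl_eq_zero (s := Ω)
      (f := fun p => κ p * w p ^ 2 * f p ^ 2) (fun p hp => by simp [z p (zΩ p hp)]),
      ← setIntegral_eq_integral_of_forall_compl_eq_zero (s := Ω)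
      (f := fun p => w p ^ 2 * f p ^ 2) (fun p hp => by simp [z p (zΩ p hp)]),
      ← integral_const_mul]
    refine integral_mono_ae (iW.restrict.const_mul _) iK.restrict ?_
    filter_upwards [hκ] with p hp
    have : 0 ≤ w p ^ 2 * f p ^ 2 := by positivity
    calc _ ≤ κ p * (w p ^ 2 * f p ^ 2) := mul_le_mul_of_nonneg_right hp.1 this
      _ = _ := by ring
  have hB0 : 0 ≤ B := integral_nonneg fun p => mul_nonneg (covecNormSq_nonneg _) (sq_nonneg _)
  have hC0 : 0 ≤ C' := integral_nonneg fun p => abs_nonneg _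
  have hCC : -C ≤ C' := (neg_le_abs C).trans abs_integral_le_integral_abs
  -- `W` is eliminated: the lower bound on `K` costs (2 − τ)/8 times `l * W`, which the eigenvalue
  -- estimate bounds by `B + C'`.
  have main : τ * A ≤ 4 * B + 2 * C' := by
    have t : 0 ≤ 2 - τ := by linarith
    have h4 : (2 - τ) * (l * W) ≤ (2 - τ) * (B + C') :=
      mul_le_mul_of_nonneg_left (by linarith) t
    have h5 : A ≤ (2 + (2 - τ) / 8) * B + (1 + (2 - τ) / 8) * C' := by linarith
    have h6 := mul_le_mul_of_nonneg_left h5 hτ₀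
    -- The slack in the coefficients: 4 − τ(2 + (2−τ)/8) = (2−τ)(16−τ)/8 for `B`, and 2 − τ(1 +
    -- (2−τ)/8) = (2−τ)(8−τ)/8 for `C'`. Both are nonnegative for τ ≤ 2.
    have h7 : 0 ≤ (2 - τ) * (16 - τ) / 8 * B :=
      mul_nonneg (div_nonneg (mul_nonneg t (by linarith)) (by norm_num)) hB0
    have h8 : 0 ≤ (2 - τ) * (8 - τ) / 8 * C' :=
      mul_nonneg (div_nonneg (mul_nonneg t (by linarith)) (by norm_num)) hC0
    linarith
  have iR : Integrable (fun p => 4 * (covecNormSq (dw p) * f p ^ 2)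
      + 2 * |w p ^ 2 * (f p * laplaceBeltrami f p)|) (riemVolume M) :=
    (iB.const_mul 4).add (iC.abs.const_mul 2)
  have hR : ∫ p, (4 * (covecNormSq (dw p) * f p ^ 2)
      + 2 * |w p ^ 2 * (f p * laplaceBeltrami f p)|) ∂riemVolume M = 4 * B + 2 * C' := by
    rw [integral_add (iB.const_mul 4) (iC.abs.const_mul 2), integral_const_mul, integral_const_mul]
  have eA : ∫⁻ p in Ω, ENNReal.ofReal (w p ^ 2 * gradSq f p) ∂riemVolume M = ENNReal.ofReal A := by
    rw [hA, ← setIntegral_eq_integral_of_forall_compl_eq_zero (s := Ω)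
      (fun p hp => by simp [gradSq_eq_zero_of_notMem_tsupport (zΩ p hp)]),
      ofReal_integral_eq_lintegral_ofReal iA.restrict
        (ae_of_all _ fun p => mul_nonneg (sq_nonneg _) (sq_nonneg _))]
  rw [eA, ← ENNReal.ofReal_mul hτ₀]
  refine (ENNReal.ofReal_le_ofReal main).trans ?_
  rw [← hR, ← setIntegral_eq_integral_of_forall_compl_eq_zero (s := Ω)
    (fun p hp => by simp [z p (zΩ p hp)]), ofReal_integral_eq_lintegral_ofReal iR.restrict
      (ae_of_all _ fun p => add_nonneg (mul_nonneg (by norm_num)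
        (mul_nonneg (covecNormSq_nonneg _) (sq_nonneg _))) (by positivity))]
  exact lintegral_mono fun p => ofReal_add_two_mul_abs_le (covecNormSq_nonneg _) (w p)
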